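/- Let $\kappa,\theta,\mu$ be cardinals with $\kappa<\theta=\mathrm{cf}(\mu)<\mu$, let $\langle\lambda_i : i<\theta\rangle$ be a strictly increasing sequence of regular cardinals below $\mu$ that is cofinal in $\mu$, let $\mathfrak a=\{\lambda_i : i<\theta\}$, and let $J=J^{\mathrm{bd}}_\theta$ be the ideal of bounded subsets of $\theta$. For $g,h\in\prod\mathfrak a=\prod_{i<\theta}\lambda_i$ write $g<_J h$ if $\{i<\theta : g(\lambda_i)\ge h(\lambda_i)\}\in J$. For a regular cardinal $\lambda$, a scale of length $\lambda$ is a $<_J$-increasing and cofinal sequence $\bar f=\langle f_\alpha : \alpha<\lambda\rangle$ in $\prod\mathfrak a$; if there is one, $\lambda=\mathrm{tcf}(\prod\mathfrak a,J)$. A partition of $\mathfrak a$ into $J$-positive pieces is a partition into pairwise disjoint sets $\mathfrak a_\ell$ with $\{i<\theta:\lambda_i\in\mathfrak a_\ell\}\notin J$ for every $\ell$. A coloring $c:[\lambda]^2\to\rho$ witnesses $\mathrm{Pr}_1(\lambda,\lambda,\rho,\tau)$ if for every $\xi<\tau$, every array $\langle t_{\alpha,\zeta} : \alpha<\lambda,\zeta<\xi\rangle$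 of ordinals below $\lambda$ whose rows $t_\alpha=\{t_{\alpha,\zeta}:\zeta<\xi\}$ are pairwise disjoint, and every $\gamma<\rho$, there are $\alpha<\beta<\lambda$ such that $c(t_{\alpha,\zeta},t_{\beta,\eta})=\gamma$ for all $\zeta,\eta<\xi$; and $\mathrm{Pr}_1(\lambda,\lambda,\rho,\tau)$ says that such a coloring exists. Call $\mathfrak a$ a tortoise set if $|\mathfrak a|<\min\mathfrak a$ and $\max\mathrm{pcf}(\mathfrak a\cap\partial)<\partial$ for every $\partial\in\mathfrak a$ (with nothing required when $\mathfrak a\cap\partial=\emptyset$), where $\mathrm{pcf}(\mathfrak b)$ is the set of all true cofinalities of $\prod\mathfrak b$ modulo proper ideals on $\mathfrak b$. (1) Suppose that $\mu^+=\mathrm{tcf}(\prod\mathfrak a,J)$, that $\mathfrak a$ is a tortoise set, and that $\{\mathfrak a_\ell : \ell<\kappa\}$ is a partition of $\mathfrak a$ into $\kappa$ disjoint $J$-positive pieces. Then there is a scale $\bar f=\langle f_\alpha:\alpha<\mu^+\rangle$ in $(\prod\mathfrak a,<_J)$ such that - for every $\partial\in\mathfrak a$ the set $\{f_\alpha\restriction(\mathfrak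 a\cap\partial) : \alpha<\mu^+\}$ has fewer than $\partial$ members; - the derived coloring $c:[\mu^+]^2\to\kappa$ witnesses $\mathrm{Pr}_1(\mu^+,\mu^+,\kappa,\aleph_0)$. Here, for $\alpha<\beta<\mu^+$, $c(\alpha,\beta)$ is the $\ell<\kappa$ with $\lambda_{i_{\alpha\beta}}\in\mathfrak a_\ell$, where $i_{\alpha\beta}$ is the first $i<\theta$ such that $f_\alpha(\lambda_j)<f_\beta(\lambda_j)$ for every $j\in[i,\theta)$. (2) Let $\lambda$ be any regular cardinal and let $\bar f=\langle f_\alpha:\alpha<\lambda\rangle$ be any scale in $(\prod\mathfrak a,<_J)$ (so $\lambda=\mathrm{tcf}(\prod\mathfrak a,J)$; no tortoise assumption is made). For $\alpha<\beta<\lambda$ let $t^+(\alpha,\beta)=\min\{\partial\in\mathfrak a:\partial\ge\sup\{\partial'\in\mathfrak a : f_\alpha(\partial')\ge f_\beta(\partial')\}\}$. Then for every cardinal $\rho$ and every partition $\{\mathfrak b_\ell:\ell<\rho\}$ of $\mathfrak a$ into $\rho$ disjoint $J$-positive pieces, the coloring that sends $\{\alpha,\beta\}$ with $\alpha<\beta$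 to the $\ell$ with $t^+(\alpha,\beta)\in\mathfrak b_\ell$ witnesses $\mathrm{Pr}_1(\lambda,\lambda,\rho,\theta)$. Moreover $\mathrm{Pr}_1(\lambda,\lambda,\theta,\theta)$ holds. -/

import Mathlib

open Cardinal Set

universe u v

/-- `J` is a proper ideal of subsets of `ι`. -/
structure IsProperIdeal {ι : Type v} (J : Set (Set ι)) : Prop where
  empty_mem : ∅ ∈ J
  subset_mem : ∀ s t : Set ι, s ⊆ t → t ∈ J → s ∈ J
  union_mem : ∀ s t : Set ι, s ∈ J → t ∈ J → s ∪ t ∈ J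
  univ_notMem : Set.univ ∉ J

/-- The ideal of bounded subsets of a linear order. -/
def boundedIdeal (ι : Type v) [LinearOrder ι] : Set (Set ι) :=
  {s | BddAbove s}

/-- The product `∏ a` of a family of cardinals: functions choosing, at each `i`, an ordinal
below `a i`. -/
abbrev CardProd {ι : Type v} (a : ι → Cardinal.{u}) : Type (max v (u + 1)) :=
  ∀ i, Set.Iio (a i).ord

/-- The relation `g <_J h` on `∏ a`: the set where `g i < h i` fails belongs to `J`. -/
def LtMod {ι : Type v} {a : ι → Cardinal.{u}} (J : Set (Set ι)) (g h : CardProd a) : Prop :=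
  {i | ¬ g i < h i} ∈ J

/-- `⟨f_α : α < ν⟩` is a `<_J`-increasing and cofinal sequence in `∏ a`. -/
structure IsScale {ι : Type v} (a : ι → Cardinal.{u}) (J : Set (Set ι)) (ν : Cardinal.{u})
    (f : Set.Iio ν.ord → CardProd a) : Prop where
  increasing : ∀ α β, α < β → LtMod J (f α) (f β)
  cofinal : ∀ g : CardProd a, ∃ α, LtMod J g (f α)

/-- `ν = tcf(∏ a, <_J)`. -/
def HasTcf {ι : Type v} (a : ι → Cardinal.{u}) (J : Set (Set ι)) (ν : Cardinal.{u}) : Prop :=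
  ν.IsRegular ∧ ∃ f : Set.Iio ν.ord → CardProd a, IsScale a J ν f

/-- `pcf(𝔟)`: all the true cofinalities of `∏ 𝔟` modulo proper ideals on `𝔟`. -/
def pcf (b : Set Cardinal.{u}) : Set Cardinal.{u} :=
  {ν | ∃ I : Set (Set b), IsProperIdeal I ∧ HasTcf (fun x : b => (x : Cardinal.{u})) I ν}

/-- A progressive set: regular cardinals, all of them larger than the cardinality of the set. -/
def IsProgressive (a : Set Cardinal.{u}) : Prop :=
  ∀ d ∈ a, d.IsRegular ∧ #a < Cardinal.lift.{u + 1} d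

/-- A tortoise set: a progressive set `𝔞` with `max pcf(𝔞 ∩ ∂) < ∂` for every `∂ ∈ 𝔞`, that is,
every member of `pcf(𝔞 ∩ ∂)` is below `∂` (nothing is required if `𝔞 ∩ ∂` is empty). -/
def IsTortoise (a : Set Cardinal.{u}) : Prop :=
  IsProgressive a ∧ ∀ d ∈ a, ∀ ν ∈ pcf (a ∩ Set.Iio d), ν < d

/-- `{A j : j < κ}` is a partition of `𝔞 = {a i : i ∈ ι}` into pairwise disjoint
`J`-positive pieces. -/
structure IsPositivePartition {ι : Type v} (a : ι → Cardinal.{u}) (J : Set (Set ι))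
    (κ : Cardinal.{u}) (A : Set.Iio κ.ord → Set Cardinal.{u}) : Prop where
  disjoint : ∀ j k, j ≠ k → Disjoint (A j) (A k)
  union : ⋃ j, A j = Set.range a
  positive : ∀ j, {i | a i ∈ A j} ∉ J

/-- The small-restriction property of `⟨f_α : α < ν⟩`, for an increasing family `a`: for every
`i` the set of all the restrictions of the `f_α` to the indices below `i` (to `𝔞 ∩ a i`) has
fewer than `a i` members. -/
def SmallRestrictions {ι : Type (u + 1)} [LinearOrder ι] (a : ι → Cardinal.{u})
    (ν : Cardinal.{u}) (f : Set.Iio ν.ord → CardProd a) : Prop :=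
  ∀ i : ι, #(Set.range fun α => fun j : Set.Iio i => f α j) < Cardinal.lift.{u + 1} (a i)

/-- Colorings of `[ν]²` are functions on unordered pairs; values on the diagonal are irrelevant.
`c` witnesses `Pr₁(ν, ρ, κ, τ)`: for every `ξ < τ`, every array `⟨t_{α,ζ} : α < ρ, ζ < ξ⟩` of
ordinals below `ν` with pairwise disjoint rows, and every color `γ < κ`, there are `α < β < ρ`
such that `c` is constantly `γ` on `t_α × t_β`. -/
def WitnessesPr1 (ν ρ κ τ : Cardinal.{u}) (c : Sym2 (Set.Iio ν.ord) → Set.Iio κ.ord) : Prop :=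
  ∀ ξ : Ordinal.{u}, ξ < τ.ord →
    ∀ t : Set.Iio ρ.ord → Set.Iio ξ → Set.Iio ν.ord,
      (∀ α β, α ≠ β → Disjoint (Set.range (t α)) (Set.range (t β))) →
        ∀ γ : Set.Iio κ.ord, ∃ α β, α < β ∧ ∀ ζ η, c s(t α ζ, t β η) = γ

/-- The principle `Pr₁(ν, ρ, κ, τ)`. -/
def Pr1 (ν ρ κ τ : Cardinal.{u}) : Prop :=
  ∃ c : Sym2 (Set.Iio ν.ord) → Set.Iio κ.ord, WitnessesPr1 ν ρ κ τ c

/-- `c` is the coloring derived from `f` and the pieces `A`: for `α < β`, if `i` is the first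
index such that `f_α(a j) < f_β(a j)` for all `j ≥ i`, then `c(α, β)` is the `ℓ` with
`a i ∈ A ℓ`. -/
def IsDerivedColoring {ι : Type v} [LinearOrder ι] (a : ι → Cardinal.{u}) (ν κ : Cardinal.{u})
    (f : Set.Iio ν.ord → CardProd a) (A : Set.Iio κ.ord → Set Cardinal.{u})
    (c : Sym2 (Set.Iio ν.ord) → Set.Iio κ.ord) : Prop :=
  ∀ α β, α < β → ∀ l, c s(α, β) = l ↔
    ∃ i, IsLeast {i | ∀ j, i ≤ j → f α j < f β j} i ∧ a i ∈ A l

/-- `c` is the last-failure coloring of `f` and the pieces `A`, for an increasing family `a`: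
for `α < β`, if `a i` is the least member of `𝔞` that is at least
`sup {∂ ∈ 𝔞 : f_α(∂) ≥ f_β(∂)}`, then `c(α, β)` is the `ℓ` with `a i ∈ A ℓ`. -/
def IsLastFailureColoring {ι : Type v} [LinearOrder ι] (a : ι → Cardinal.{u})
    (ν κ : Cardinal.{u}) (f : Set.Iio ν.ord → CardProd a)
    (A : Set.Iio κ.ord → Set Cardinal.{u}) (c : Sym2 (Set.Iio ν.ord) → Set.Iio κ.ord) : Prop :=
  ∀ α β, α < β → ∀ l, c s(α, β) = l ↔
    ∃ i, IsLeast (upperBounds {j | f β j ≤ f α j}) i ∧ a i ∈ A l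

/-! Both colorings are handled by one argument, `IsScale.exists_separated_rows`. Call the
restriction to `L i` of a bound `M β` for the row `t β` its type at `i`. From a fixed index `i₀` on,
every type is dominated on `L i ∩ [i₀, i]` by a whole row, and one such row is chosen for each `i`
and each type. There are fewer than `a j` types when `j ∈ U i`, so all the chosen rows are bounded
by a single `χ ∈ ∏ a` on a tail. A late row `t β` eventually exceeds `χ`. At any large `i` of the
required color, the row `t α` chosen for the type of `t β` dominates `t β` just before the change at
`i`, while `t β` dominates `t α` after it.

For the last-failure coloring, `L i = {i}` and `U i = (i, θ)`. There are at most `a i` types, so any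
scale works. For the derived coloring, `L i = [0, i)` and `U i = [i, θ)`. Now fewer than `a i` types
are needed, which follows from small restrictions when the rows are finite.

A scale with small restrictions comes from pcf theory. For regular `l` there is a universal
sequence, increasing modulo `J_{<l}` and cofinal in every ultraproduct of cofinality `l`. Any `g` is
raised in `θ⁺` steps to a function `h` whose restriction to each `𝔞 ∩ ∂` (on a tail of `𝔞`) is a
finite maximum of functions `clubBound γ (f l)` (`IsProgressiveFamily.exists_ge_clubBound`). These
depend only on pairs `(l, γ)` with `γ < l ≤ max pcf(𝔞 ∩ ∂)`. By the tortoise condition there are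
fewer than `∂` finite sets of such pairs, hence fewer than `∂` restrictions. Interleaving these
functions with a given scale produces the required one. -/

/-! ### Transfinite recursion and bounds from regularity. -/

/-- Transfinite recursion with choice: if every sequence that satisfies the requirement `Q` below
`α` can be continued at `α`, for all `α < o`, there is a sequence satisfying `Q` below `o`. -/
theorem exists_transfinite {X : Type v} [Nonempty X] (o : Ordinal.{u})
    (Q : (α : Ordinal.{u}) → (Set.Iio α → X) → X → Prop)
    (hQ : ∀ α < o, ∀ s : Set.Iio α → X,
      (∀ β : Set.Iio α, Q β (fun δ => s ⟨δ, Set.mem_Iio.2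
        (lt_trans (Set.mem_Iio.1 δ.2) (Set.mem_Iio.1 β.2))⟩) (s β)) → ∃ x, Q α s x) :
    ∃ h : Ordinal.{u} → X, ∀ α < o, Q α (fun β => h β) (h α) := by
  classical
  let F : (α : Ordinal.{u}) → ((β : Ordinal.{u}) → β < α → X) → X := fun α ih =>
    if H : ∃ x, Q α (fun β => ih β (Set.mem_Iio.1 β.2)) x then H.choose else Classical.arbitrary X
  let h : Ordinal.{u} → X := WellFounded.fix Ordinal.lt_wf F
  have hh : ∀ α, h α = F α (fun β _ => h β) := fun α => WellFounded.fix_eq _ _ _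
  refine ⟨h, fun α => ?_⟩
  induction α using WellFoundedLT.induction with
  | ind α ih =>
    intro hα
    have H : ∃ x, Q α (fun β : Set.Iio α => h β) x :=
      hQ α hα _ fun β => ih β β.2 (lt_trans (Set.mem_Iio.1 β.2) hα)
    rw [hh α]
    simp only [F, dif_pos H]
    exact H.choose_spec

theorem exists_lt_ord_of_mk_lt {T : Type (u + 1)} {c : Cardinal.{u}} (hc : c.IsRegular)
    (hT : #T < Cardinal.lift.{u + 1} c) (F : T → Ordinal.{u}) (hF : ∀ t, F t < c.ord) :
    ∃ b < c.ord, ∀ t, F t < b := by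
  have : Small.{u} T := by
    rw [small_iff_lift_mk_lt_univ]
    simpa using hT.trans (Cardinal.lift_lt_univ c)
  refine ⟨⨆ t, (F t + 1), ?_, fun t => ?_⟩
  · apply Ordinal.lift_iSup_add_one_lt_of_lt_cof _ hF
    rw [← Ordinal.lift_cof, hc.cof_ord, Cardinal.lift_id'.{u, u + 1}]
    exact hT
  · exact (Order.lt_add_one_iff.2 le_rfl).trans_le (Ordinal.le_iSup (fun t => F t + 1) t)

theorem exists_ordinal_enum {T : Type (u + 1)} [Nonempty T] {c : Cardinal.{u}}
    (hT : #T ≤ Cardinal.lift.{u + 1} c) :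
    ∃ e : Ordinal.{u} → T, ∀ t, ∃ γ < c.ord, e γ = t := by
  classical
  have h : #T ≤ #(Set.Iio c.ord) := by simpa using hT
  obtain ⟨f⟩ := h
  refine ⟨fun γ => if H : ∃ t, (f t : Ordinal) = γ then H.choose else Classical.arbitrary T,
    fun t => ⟨f t, (f t).2, ?_⟩⟩
  have H : ∃ t', (f t' : Ordinal) = f t := ⟨t, rfl⟩
  simp only [dif_pos H]
  exact f.injective (Subtype.ext H.choose_spec)

theorem exists_isCofinal_Iio_ord (c : Cardinal.{u}) :
    ∃ S : Set (Set.Iio c.ord), IsCofinal S ∧ #S = Cardinal.lift.{u + 1} c.ord.cof := by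
  obtain ⟨S, hS, h⟩ := Order.exists_cof_eq (Set.Iio c.ord)
  exact ⟨S, hS, by rw [h, Ordinal.cof_Iio, Ordinal.lift_cof]⟩

/-- A family of regular cardinals, all of them larger than a regular `κ` that exceeds the size of
the index set. -/
structure IsProgressiveFamily {ι : Type (u + 1)} (a : ι → Cardinal.{u}) (κ : Cardinal.{u}) :
    Prop where
  isRegular : ∀ i, (a i).IsRegular
  isRegular_bound : κ.IsRegular
  bound_lt : ∀ i, κ < a i
  mk_lt : #ι < Cardinal.lift.{u + 1} κ

theorem CardProd.exists_gt {ι : Type (u + 1)} {a : ι → Cardinal.{u}}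
    (ha : ∀ i, (a i).IsRegular) {T : Type (u + 1)} (hT : ∀ i, #T < Cardinal.lift.{u + 1} (a i))
    (F : T → CardProd a) : ∃ h : CardProd a, ∀ t i, F t i < h i := by
  choose b hb hF using fun i =>
    exists_lt_ord_of_mk_lt (ha i) (hT i) (fun t => (F t i : Ordinal)) (fun t => (F t i).2)
  exact ⟨fun i => ⟨b i, hb i⟩, fun t i => hF i t⟩

/-! ### Cofinalities of ultraproducts. -/

section Ultrapower

variable {ι : Type (u + 1)} {a : ι → Cardinal.{u}} {κ : Cardinal.{u}}

/-- The cofinality of the ultraproduct `∏ a / D`. -/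
noncomputable def ultraCof (a : ι → Cardinal.{u}) (D : Ultrafilter ι) : Cardinal.{u} :=
  sInf {c | ∃ F : Ordinal.{u} → CardProd a, ∀ g : CardProd a, ∃ γ < c.ord,
    ∀ᶠ i in (D : Filter ι), g i ≤ F γ i}

theorem IsProgressiveFamily.nonempty (ha : IsProgressiveFamily a κ) : Nonempty (CardProd a) :=
  ⟨fun i => ⟨0, (ha.isRegular i).ord_pos⟩⟩

theorem IsProgressiveFamily.exists_gt (ha : IsProgressiveFamily a κ) {T : Type (u + 1)}
    (hT : #T ≤ Cardinal.lift.{u + 1} κ) (F : T → CardProd a) :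
    ∃ h : CardProd a, ∀ t i, F t i < h i :=
  CardProd.exists_gt ha.isRegular
    (fun i => hT.trans_lt (Cardinal.lift_lt.2 (ha.bound_lt i))) F

theorem IsProgressiveFamily.small (ha : IsProgressiveFamily a κ) : Small.{u} ι := by
  rw [small_iff_lift_mk_lt_univ]
  simpa using ha.mk_lt.trans (Cardinal.lift_lt_univ κ)

/-- Source of the contradictions below: a construction of length `κ` that spends a new coordinate at
every step cannot exist. -/
theorem IsProgressiveFamily.not_injective (ha : IsProgressiveFamily a κ)
    (e : Set.Iio κ.ord → ι) : ¬ Function.Injective e := by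
  intro he
  have := Cardinal.mk_le_of_injective he
  rw [Cardinal.mk_Iio_ordinal, Cardinal.card_ord] at this
  exact absurd ha.mk_lt this.not_gt

theorem IsProgressiveFamily.exists_ultraCof_cofinal (ha : IsProgressiveFamily a κ)
    (D : Ultrafilter ι) : ∃ F : Ordinal.{u} → CardProd a, ∀ g : CardProd a,
      ∃ γ < (ultraCof a D).ord, ∀ᶠ i in (D : Filter ι), g i ≤ F γ i := by
  refine csInf_mem (s := {c : Cardinal.{u} | ∃ F : Ordinal.{u} → CardProd a,
    ∀ g : CardProd a, ∃ γ < c.ord,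
    ∀ᶠ i in (D : Filter ι), g i ≤ F γ i}) ?_
  -- The product is small, so enumerating all of it shows that the infimum defining `ultraCof` is
  -- over a nonempty set.
  have := ha.small
  have hs : Small.{u} (CardProd a) := inferInstance
  have := ha.nonempty
  rw [small_iff_lift_mk_lt_univ] at hs
  obtain ⟨c, hc⟩ := Cardinal.lt_univ.1 (by rwa [Cardinal.lift_id] at hs)
  obtain ⟨e, he⟩ := exists_ordinal_enum (T := CardProd a) (c := c) hc.le
  refine ⟨c, e, fun g => ?_⟩
  obtain ⟨γ, hγ, rfl⟩ := he g
  exact ⟨γ, hγ, by simp⟩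

theorem IsProgressiveFamily.exists_gt_of_lt_ultraCof (ha : IsProgressiveFamily a κ)
    (D : Ultrafilter ι) {T : Type (u + 1)} (hT : #T < Cardinal.lift.{u + 1} (ultraCof a D))
    (F : T → CardProd a) : ∃ h : CardProd a, ∀ t, ∀ᶠ i in (D : Filter ι), F t i < h i := by
  have := ha.nonempty
  rcases isEmpty_or_nonempty T with hE | hE
  · exact ⟨Classical.arbitrary _, fun t => hE.elim t⟩
  obtain ⟨c, hc, hcT⟩ := Cardinal.lt_lift_iff.1 hT
  obtain ⟨e, he⟩ := exists_ordinal_enum (T := T) (c := c) hcT.ge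
  have := notMem_of_lt_csInf' hc
  simp only [Set.mem_ofPred_eq, not_exists, not_forall] at this
  obtain ⟨h, hh⟩ := this (fun γ => F (e γ))
  refine ⟨h, fun t => ?_⟩
  obtain ⟨γ, hγ, rfl⟩ := he t
  have h1 := hh γ
  simp only [not_and] at h1
  simpa using Ultrafilter.eventually_not.2 (h1 hγ)

theorem IsProgressiveFamily.lt_ultraCof (ha : IsProgressiveFamily a κ) (D : Ultrafilter ι) :
    κ < ultraCof a D := by
  by_contra! hle
  obtain ⟨F, hF⟩ := ha.exists_ultraCof_cofinal D
  obtain ⟨h, hh⟩ := ha.exists_gt (T := Set.Iio (ultraCof a D).ord) (by simpa using hle)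
    (fun γ => F γ)
  obtain ⟨γ, hγ, hg⟩ := hF h
  obtain ⟨i, hi⟩ := hg.exists
  exact absurd (hh ⟨γ, hγ⟩ i) hi.not_gt

theorem mk_Iio_lt_lift {c : Cardinal.{u}} {γ : Ordinal.{u}} (h : γ < c.ord) :
    #(Set.Iio γ) < Cardinal.lift.{u + 1} c := by
  rw [Cardinal.mk_Iio_ordinal, Cardinal.lift_lt]
  exact Cardinal.lt_ord.1 h

theorem IsProgressiveFamily.isRegular_ultraCof (ha : IsProgressiveFamily a κ)
    (D : Ultrafilter ι) : (ultraCof a D).IsRegular := by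
  have hinf : ℵ₀ ≤ ultraCof a D :=
    ha.isRegular_bound.aleph0_le.trans (ha.lt_ultraCof D).le
  refine ⟨hinf, ?_⟩
  by_contra! hlt
  obtain ⟨F, hF⟩ := ha.exists_ultraCof_cofinal D
  obtain ⟨S, hS, hcard⟩ := exists_isCofinal_Iio_ord (ultraCof a D)
  choose G hG using fun s : S => ha.exists_gt_of_lt_ultraCof D
    (T := Set.Iio (Order.succ (s : Ordinal)))
    (mk_Iio_lt_lift ((Cardinal.isSuccLimit_ord hinf).succ_lt s.1.2)) (fun γ => F γ)
  obtain ⟨h, hh⟩ := ha.exists_gt_of_lt_ultraCof D (T := S)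
    (by rw [hcard]; exact Cardinal.lift_lt.2 hlt) G
  obtain ⟨γ, hγ, hg⟩ := hF h
  obtain ⟨s, hs, hle⟩ := hS ⟨γ, hγ⟩
  obtain ⟨i, h1, h2, h3⟩ :=
    (hg.and ((hG ⟨s, hs⟩ ⟨γ, Set.mem_Iio.2 (Order.lt_succ_iff.2 (Subtype.coe_le_coe.2 hle))⟩).and
      (hh ⟨s, hs⟩))).exists
  exact absurd (h1.trans_lt (h2.trans h3)) (lt_irrefl _)

theorem IsProgressiveFamily.exists_increasing_cofinal (ha : IsProgressiveFamily a κ)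
    (D : Ultrafilter ι) : ∃ G : Ordinal.{u} → CardProd a,
      (∀ γ < (ultraCof a D).ord, ∀ δ < γ, ∀ᶠ i in (D : Filter ι), G δ i < G γ i) ∧
      ∀ g : CardProd a, ∃ γ < (ultraCof a D).ord, ∀ᶠ i in (D : Filter ι), g i < G γ i := by
  obtain ⟨F, hF⟩ := ha.exists_ultraCof_cofinal D
  have := ha.nonempty
  obtain ⟨G, hG⟩ := exists_transfinite (X := CardProd a) (ultraCof a D).ord
    (fun γ s x => (∀ δ, ∀ᶠ i in (D : Filter ι), s δ i < x i) ∧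
      ∀ᶠ i in (D : Filter ι), F γ i < x i) (fun γ hγ s _ => by
    obtain ⟨x, hx⟩ := ha.exists_gt_of_lt_ultraCof D (mk_Iio_lt_lift hγ) s
    have h1 : #PUnit.{u + 2} < Cardinal.lift.{u + 1} (ultraCof a D) := by
      simpa using (ha.isRegular_ultraCof D).nat_lt 1
    obtain ⟨y, hy⟩ := ha.exists_gt_of_lt_ultraCof D h1 (fun _ => F γ)
    refine ⟨fun i => max (x i) (y i), fun δ => ?_, ?_⟩
    · exact (hx δ).mono fun i hi => lt_max_of_lt_left hi
    · exact (hy ⟨⟩).mono fun i hi => lt_max_of_lt_right hi)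
  refine ⟨G, fun γ hγ δ hδ => (hG γ hγ).1 ⟨δ, hδ⟩, fun g => ?_⟩
  obtain ⟨γ, hγ, hg⟩ := hF g
  exact ⟨γ, hγ, (hg.and (hG γ hγ).2).mono fun i hi => hi.1.trans_lt hi.2⟩

end Ultrapower

/-! ### The ideals `J_{<l}`, directedness, and the existence of max pcf. -/

section CofFilter

variable {ι : Type (u + 1)} {a : ι → Cardinal.{u}} {κ : Cardinal.{u}}

/-- The intersection of all the ultrafilters `D` with `cof (∏ a / D) ≥ c`; it is dual to the ideal
`J_{<c}` of pcf theory. -/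
noncomputable def cofFilter (a : ι → Cardinal.{u}) (c : Cardinal.{u}) : Filter ι :=
  ⨆ D : {D : Ultrafilter ι // c ≤ ultraCof a D}, ((D : Ultrafilter ι) : Filter ι)

theorem eventually_cofFilter {c : Cardinal.{u}} {p : ι → Prop} :
    (∀ᶠ i in cofFilter a c, p i) ↔
      ∀ D : Ultrafilter ι, c ≤ ultraCof a D → ∀ᶠ i in (D : Filter ι), p i := by
  simp [cofFilter, Filter.eventually_iSup]

theorem cofFilter_antitone : Antitone (cofFilter a) := by
  intro c d hcd s hs
  exact eventually_cofFilter.2 fun D hD => eventually_cofFilter.1 hs D (hcd.trans hD)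

theorem le_cofFilter_ultraCof (D : Ultrafilter ι) :
    (D : Filter ι) ≤ cofFilter a (ultraCof a D) :=
  fun _ hs => eventually_cofFilter.1 hs D le_rfl

/-- If no bound exists, each `h` is overtaken modulo some `D` with `l ≤ ultraCof a D`, while `c < l`
still bounds the whole sequence by some `n h` modulo `D`. Iterate `κ` times with `H β` above all
earlier `n (H α)`, and fix one late `γ`. A coordinate with `H α < F γ ≤ n (H α)` can serve only one
`α`. -/
theorem IsProgressiveFamily.exists_cofFilter_bound_of_isRegular (ha : IsProgressiveFamily a κ)
    {c l : Cardinal.{u}} (hc : c.IsRegular) (hκ : κ < c) (hcl : c < l)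
    (F : Ordinal.{u} → CardProd a)
    (hF : ∀ γ < c.ord, ∀ δ < γ, ∀ᶠ i in cofFilter a l, F δ i ≤ F γ i) :
    ∃ h : CardProd a, ∀ γ < c.ord, ∀ᶠ i in cofFilter a l, F γ i ≤ h i := by
  by_contra! hno
  have key : ∀ h : CardProd a, ∃ γ < c.ord, ∃ D : Ultrafilter ι, ∃ h' : CardProd a,
      ∀ δ < c.ord, γ ≤ δ → ∀ᶠ i in (D : Filter ι), h i < F δ i ∧ F δ i ≤ h' i := by
    intro h
    obtain ⟨γ, hγ, hg⟩ := hno h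
    have hg' : ¬ ∀ᶠ i in cofFilter a l, F γ i ≤ h i := by
      simpa only [Filter.not_eventually, not_le] using hg
    rw [eventually_cofFilter] at hg'
    push Not at hg'
    obtain ⟨D, hD, hDγ⟩ := hg'
    obtain ⟨h', hh'⟩ := ha.exists_gt_of_lt_ultraCof D (T := Set.Iio c.ord)
      (by simpa using hcl.trans_le hD) (fun γ => F γ)
    refine ⟨γ, hγ, D, h', fun δ hδ hle => ?_⟩
    have h2 : ∀ᶠ i in (D : Filter ι), F γ i ≤ F δ i := by
      rcases hle.eq_or_lt with rfl | hlt
      · simp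
      · exact eventually_cofFilter.1 (hF δ hδ γ hlt) D hD
    filter_upwards [hDγ, h2, hh' ⟨δ, hδ⟩] with i h3 h4 h5
    exact ⟨h3.trans_le h4, h5.le⟩
  choose g hg D n hn using key
  have := ha.nonempty
  obtain ⟨H, hH⟩ := exists_transfinite (X := CardProd a) κ.ord
    (fun α s x => ∀ β i, n (s β) i < x i)
    (fun α hα s _ => ha.exists_gt (mk_Iio_lt_lift hα).le fun β => n (s β))
  obtain ⟨γ, hγ, hlt⟩ := exists_lt_ord_of_mk_lt hc (T := Set.Iio κ.ord) (by simpa using hκ)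
    (fun α => g (H α)) (fun α => hg _)
  choose e he using fun α : Set.Iio κ.ord => (hn (H α) γ hγ (hlt α).le).exists
  refine ha.not_injective e fun α β hαβ => ?_
  have aux : ∀ α β : Set.Iio κ.ord, α < β → e α ≠ e β := by
    intro α β hlt heq
    have h1 := (he α).2
    have h2 := hH β β.2 ⟨α, hlt⟩ (e α)
    have h3 := (he β).1
    rw [← heq] at h3
    exact absurd (h1.trans_lt (h2.trans h3)) (lt_irrefl _)
  rcases lt_trichotomy α β with h | h | h
  · exact absurd hαβ (aux _ _ h)
  · exact h
  · exact absurd hαβ.symm (aux _ _ h)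

/-- `∏ a / J_{<l}` is `l`-directed. -/
theorem IsProgressiveFamily.exists_cofFilter_bound (ha : IsProgressiveFamily a κ)
    {l : Cardinal.{u}} {T : Type (u + 1)} (hT : #T < Cardinal.lift.{u + 1} l)
    (F : T → CardProd a) :
    ∃ h : CardProd a, ∀ t, ∀ᶠ i in cofFilter a l, F t i ≤ h i := by
  obtain ⟨c, hcl, hcT⟩ := Cardinal.lt_lift_iff.1 hT
  clear hT
  induction c using WellFoundedLT.induction generalizing T with
  | ind c ih =>
    rcases le_or_gt c κ with hκ | hκ
    · obtain ⟨h, hh⟩ := ha.exists_gt (T := T) (by rw [← hcT]; exact Cardinal.lift_le.2 hκ) F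
      exact ⟨h, fun t => Filter.Eventually.of_forall fun i => (hh t i).le⟩
    have hinf : ℵ₀ ≤ c := ha.isRegular_bound.aleph0_le.trans hκ.le
    have hne : Nonempty T := by
      rw [← Cardinal.mk_ne_zero_iff, ← hcT]
      simpa using (Cardinal.aleph0_pos.trans_le hinf).ne'
    obtain ⟨e, he⟩ := exists_ordinal_enum hcT.ge
    have hlow : ∀ γ < c.ord, ∀ s : Set.Iio γ → CardProd a,
        ∃ h : CardProd a, ∀ δ, ∀ᶠ i in cofFilter a l, s δ i ≤ h i := fun γ hγ s =>
      ih γ.card (Cardinal.lt_ord.1 hγ) s ((Cardinal.lt_ord.1 hγ).trans hcl) (by simp)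
    have := ha.nonempty
    -- For regular `c` the family is first replaced by an increasing sequence above it; for singular
    -- `c` it suffices to bound the bounds of cofinally many initial segments.
    rcases Cardinal.isRegular_or_isSingular hinf with hreg | hsing
    · obtain ⟨G, hG⟩ := exists_transfinite (X := CardProd a) c.ord
        (fun γ s x => (∀ δ, ∀ᶠ i in cofFilter a l, s δ i ≤ x i) ∧ ∀ i, F (e γ) i ≤ x i)
        (fun γ hγ s _ => by
          obtain ⟨h, hh⟩ := hlow γ hγ s
          exact ⟨fun i => max (h i) (F (e γ) i),
            fun δ => (hh δ).mono fun i hi => le_max_of_le_left hi, fun i => le_max_right _ _⟩)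
      obtain ⟨h, hh⟩ := ha.exists_cofFilter_bound_of_isRegular hreg hκ hcl G
        (fun γ hγ δ hδ => (hG γ hγ).1 ⟨δ, hδ⟩)
      refine ⟨h, fun t => ?_⟩
      obtain ⟨γ, hγ, rfl⟩ := he t
      exact (hh γ hγ).mono fun i hi => ((hG γ hγ).2 i).trans hi
    · obtain ⟨S, hS, hcard⟩ := exists_isCofinal_Iio_ord c
      choose G hG using fun s : S => hlow (Order.succ (s : Ordinal))
        ((Cardinal.isSuccLimit_ord hinf).succ_lt s.1.2) (fun γ => F (e γ))
      obtain ⟨h, hh⟩ := ih c.ord.cof hsing.cof_ord_lt G (hsing.cof_ord_lt.trans hcl) hcard.symm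
      refine ⟨h, fun t => ?_⟩
      obtain ⟨γ, hγ, rfl⟩ := he t
      obtain ⟨s, hs, hle⟩ := hS ⟨γ, hγ⟩
      filter_upwards [hG ⟨s, hs⟩ ⟨γ, Set.mem_Iio.2 (Order.lt_succ_iff.2
        (Subtype.coe_le_coe.2 hle))⟩, hh ⟨s, hs⟩] with i h1 h2
      exact h1.trans h2

theorem IsProgressiveFamily.exists_cofFilter_gt (ha : IsProgressiveFamily a κ)
    {l : Cardinal.{u}} {T : Type (u + 1)} (hT : #T < Cardinal.lift.{u + 1} l)
    (F : T → CardProd a) :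
    ∃ h : CardProd a, ∀ t, ∀ᶠ i in cofFilter a l, F t i < h i := by
  obtain ⟨h, hh⟩ := ha.exists_cofFilter_bound hT F
  obtain ⟨h', hh'⟩ := ha.exists_gt (T := PUnit) (by simpa using (ha.isRegular_bound.nat_lt 1).le)
    (fun _ => h)
  exact ⟨h', fun t => (hh t).mono fun i hi => hi.trans_lt (hh' ⟨⟩ i)⟩

/-- An ultrafilter below a join need not be one of those joined; directedness shows that no new
cofinalities below `l` arise. -/
theorem IsProgressiveFamily.le_ultraCof_of_le_cofFilter (ha : IsProgressiveFamily a κ)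
    {l : Cardinal.{u}} {D : Ultrafilter ι} (hD : (D : Filter ι) ≤ cofFilter a l) :
    l ≤ ultraCof a D := by
  by_contra! hlt
  obtain ⟨F, hF⟩ := ha.exists_ultraCof_cofinal D
  obtain ⟨h, hh⟩ := ha.exists_cofFilter_gt (T := Set.Iio (ultraCof a D).ord) (l := l)
    (by simpa using hlt) (fun γ => F γ)
  obtain ⟨γ, hγ, hg⟩ := hF h
  obtain ⟨i, h1, h2⟩ := (hg.and (hD (hh ⟨γ, hγ⟩))).exists
  exact absurd h2 h1.not_gt

/-- The largest cofinality of an ultraproduct `∏ a / D` with `Y ∈ D`, that is, `max pcf(Y)`. -/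
noncomputable def maxCof (a : ι → Cardinal.{u}) (Y : Set ι) : Cardinal.{u} :=
  sSup {c | ∃ D : Ultrafilter ι, Y ∈ D ∧ ultraCof a D = c}

/-- Compactness: the filters `L D` form a chain of proper filters, and an ultrafilter below all of
them has cofinality at least every `ultraCof a D'`. -/
theorem IsProgressiveFamily.exists_isGreatest (ha : IsProgressiveFamily a κ) {Y : Set ι}
    (hY : Y.Nonempty) : ∃ D : Ultrafilter ι, Y ∈ D ∧
      ∀ D' : Ultrafilter ι, Y ∈ D' → ultraCof a D' ≤ ultraCof a D := by
  let S := {D : Ultrafilter ι // Y ∈ D}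
  have hS : Nonempty S := by
    obtain ⟨i, hi⟩ := hY
    exact ⟨⟨pure i, hi⟩⟩
  let L : S → Filter ι := fun D => cofFilter a (ultraCof a D.1) ⊓ Filter.principal Y
  have hdir : Directed (· ≥ ·) L := by
    intro D D'
    rcases le_total (ultraCof a D.1) (ultraCof a D'.1) with h | h
    · exact ⟨D', inf_le_inf_right _ (cofFilter_antitone h), le_rfl⟩
    · exact ⟨D, le_rfl, inf_le_inf_right _ (cofFilter_antitone h)⟩
  have hne : (⨅ D, L D).NeBot := by
    refine Filter.iInf_neBot_of_directed' hdir fun D => ?_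
    exact Filter.NeBot.mono D.1.neBot'
      (le_inf (le_cofFilter_ultraCof D.1) (Filter.le_principal_iff.2 D.2))
  obtain ⟨D, hD⟩ := @Ultrafilter.exists_le _ _ hne
  have hle : ∀ D' : S, (D : Filter ι) ≤ L D' := fun D' => hD.trans (iInf_le _ D')
  refine ⟨D, ?_, fun D' hD' => ?_⟩
  · exact Filter.le_principal_iff.1 ((hle hS.some).trans inf_le_right)
  · exact ha.le_ultraCof_of_le_cofFilter ((hle ⟨D', hD'⟩).trans inf_le_left)

theorem IsProgressiveFamily.isGreatest_maxCof (ha : IsProgressiveFamily a κ) {Y : Set ι}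
    (hY : Y.Nonempty) :
    IsGreatest {c | ∃ D : Ultrafilter ι, Y ∈ D ∧ ultraCof a D = c} (maxCof a Y) := by
  obtain ⟨D, hD, hmax⟩ := ha.exists_isGreatest hY
  have : IsGreatest {c | ∃ D : Ultrafilter ι, Y ∈ D ∧ ultraCof a D = c} (ultraCof a D) := by
    refine ⟨⟨D, hD, rfl⟩, ?_⟩
    rintro _ ⟨D', hD', rfl⟩
    exact hmax D' hD'
  rwa [maxCof, this.csSup_eq]

theorem IsProgressiveFamily.ultraCof_le_maxCof (ha : IsProgressiveFamily a κ) {Y : Set ι}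
    {D : Ultrafilter ι} (hD : Y ∈ D) : ultraCof a D ≤ maxCof a Y :=
  (ha.isGreatest_maxCof (Ultrafilter.nonempty_of_mem hD)).2 ⟨D, hD, rfl⟩

theorem IsProgressiveFamily.exists_ultraCof_eq_maxCof (ha : IsProgressiveFamily a κ) {Y : Set ι}
    (hY : Y.Nonempty) : ∃ D : Ultrafilter ι, Y ∈ D ∧ ultraCof a D = maxCof a Y :=
  (ha.isGreatest_maxCof hY).1

end CofFilter

/-! ### Universal sequences. -/

section Universal

variable {ι : Type (u + 1)} {a : ι → Cardinal.{u}} {κ : Cardinal.{u}}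

/-- A universal sequence for `l`: it increases modulo `J_{<l}` and is cofinal in every ultraproduct
of cofinality `l`. -/
structure IsUniversalSeq (a : ι → Cardinal.{u}) (l : Cardinal.{u})
    (f : Ordinal.{u} → CardProd a) : Prop where
  increasing : ∀ γ < l.ord, ∀ δ < γ, ∀ᶠ i in cofFilter a l, f δ i ≤ f γ i
  cofinal : ∀ D : Ultrafilter ι, ultraCof a D = l → ∀ g : CardProd a,
    ∃ γ < l.ord, ∀ᶠ i in (D : Filter ι), g i ≤ f γ i

theorem IsProgressiveFamily.exists_increasing_ge (ha : IsProgressiveFamily a κ)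
    (l : Cardinal.{u}) (F : Ordinal.{u} → CardProd a) :
    ∃ f : Ordinal.{u} → CardProd a,
      (∀ γ < l.ord, ∀ δ < γ, ∀ᶠ i in cofFilter a l, f δ i ≤ f γ i) ∧
      ∀ γ < l.ord, ∀ i, F γ i ≤ f γ i := by
  have := ha.nonempty
  obtain ⟨f, hf⟩ := exists_transfinite (X := CardProd a) l.ord
    (fun γ s x => (∀ δ, ∀ᶠ i in cofFilter a l, s δ i ≤ x i) ∧ ∀ i, F γ i ≤ x i)
    (fun γ hγ s _ => by
      obtain ⟨h, hh⟩ := ha.exists_cofFilter_bound (mk_Iio_lt_lift hγ) s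
      exact ⟨fun i => max (h i) (F γ i),
        fun δ => (hh δ).mono fun i hi => le_max_of_le_left hi, fun i => le_max_right _ _⟩)
  exact ⟨f, fun γ hγ δ hδ => (hf γ hγ).1 ⟨δ, hδ⟩, fun γ hγ => (hf γ hγ).2⟩

/-- Were every increasing `f` bounded by some `g f` modulo some `D f` of cofinality `l`, iterate `κ`
times, each sequence absorbing the earlier bounds `g` and cofinal sequences `G`. With `h` above all
the bounds, at a late `γ` each step has a coordinate where the sequence passes from below `h` to at
least `h`. Since the values at `γ` only grow, no coordinate does this twice. -/
theorem IsProgressiveFamily.exists_isUniversalSeq (ha : IsProgressiveFamily a κ)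
    {l : Cardinal.{u}} (hl : l.IsRegular) (hκ : κ < l) :
    ∃ f : Ordinal.{u} → CardProd a, IsUniversalSeq a l f := by
  by_contra! hno
  have := ha.nonempty
  let X := {f : Ordinal.{u} → CardProd a //
    ∀ γ < l.ord, ∀ δ < γ, ∀ᶠ i in cofFilter a l, f δ i ≤ f γ i}
  have key : ∀ f : X, ∃ D : Ultrafilter ι, ∃ g : CardProd a, ∃ G : Ordinal.{u} → CardProd a,
      ultraCof a D = l ∧ (∀ γ < l.ord, ∀ᶠ i in (D : Filter ι), f.1 γ i < g i) ∧
      ∀ h : CardProd a, ∃ γ < l.ord, ∀ᶠ i in (D : Filter ι), h i ≤ G γ i := by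
    intro f
    by_contra! hf
    refine hno f.1 ⟨f.2, fun D hD g => ?_⟩
    by_contra! hg
    obtain ⟨G, hG⟩ := ha.exists_ultraCof_cofinal D
    rw [hD] at hG
    obtain ⟨h, hh⟩ := hf D g G hD hg
    obtain ⟨γ, hγ, hle⟩ := hG h
    obtain ⟨i, h1, h2⟩ := ((hh γ hγ : ∀ᶠ i in (D : Filter ι), G γ i < h i).and hle).exists
    exact absurd h2 h1.not_ge
  choose D g G hD hg hG using key
  let nxt : X → Ordinal.{u} → CardProd a := fun f γ i => max (f.1 γ i) (max (g f i) (G f γ i))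
  have hX : Nonempty X := by
    obtain ⟨f, hf, -⟩ := ha.exists_increasing_ge l (fun _ => Classical.arbitrary _)
    exact ⟨⟨f, hf⟩⟩
  obtain ⟨H, hH⟩ := exists_transfinite (X := X) κ.ord
    (fun α s x => ∀ β, ∀ γ < l.ord, ∀ i, nxt (s β) γ i ≤ x.1 γ i)
    (fun α hα s _ => by
      choose F hF using fun γ => ha.exists_gt (mk_Iio_lt_lift hα).le (fun β => nxt (s β) γ)
      obtain ⟨f, hf, hFf⟩ := ha.exists_increasing_ge l F
      exact ⟨⟨f, hf⟩, fun β γ hγ i => (hF γ β i).le.trans (hFf γ hγ i)⟩)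
  obtain ⟨h, hh⟩ := ha.exists_gt (T := Set.Iio κ.ord) (by simp) (fun α => (H α).1 0)
  choose γ' hγ' hle using fun α : Set.Iio κ.ord => hG (H α) h
  obtain ⟨γ, hγ, hlt⟩ := exists_lt_ord_of_mk_lt hl (T := Set.Iio κ.ord) (by simpa using hκ) γ' hγ'
  have hsucc : ∀ α : Set.Iio κ.ord, Order.succ (α : Ordinal) < κ.ord := fun α =>
    (Cardinal.isSuccLimit_ord ha.isRegular_bound.aleph0_le).succ_lt α.2
  have hstep : ∀ α : Set.Iio κ.ord, ∃ i, (H α).1 γ i < h i ∧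
      h i ≤ (H (Order.succ (α : Ordinal))).1 γ i := by
    intro α
    have hinc := eventually_cofFilter.1 ((H (Order.succ (α : Ordinal))).2 γ hγ _ (hlt α))
      (D (H α)) (hD _).ge
    obtain ⟨i, h1, h2, h3⟩ := ((hg (H α) γ hγ).and (hinc.and (hle α))).exists
    have hmem : (α : Ordinal) ∈ Set.Iio (Order.succ (α : Ordinal)) :=
      Set.mem_Iio.2 (Order.lt_succ _)
    refine ⟨i, ?_, ?_⟩
    · have h4 := hH _ (hsucc α) ⟨α, hmem⟩ 0 hl.ord_pos i
      have h5 : g (H α) i ≤ nxt (H α) 0 i := le_max_of_le_right (le_max_left _ _)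
      exact h1.trans ((h5.trans h4).trans_lt (hh ⟨_, hsucc α⟩ i))
    · have h4 := hH _ (hsucc α) ⟨α, hmem⟩ _ (hγ' α) i
      have h5 : G (H α) (γ' α) i ≤ nxt (H α) (γ' α) i :=
        le_max_of_le_right (le_max_right _ _)
      exact ((h3.trans h5).trans h4).trans h2
  choose e he using hstep
  refine ha.not_injective e fun α β hαβ => ?_
  have aux : ∀ α β : Set.Iio κ.ord, α < β → e α ≠ e β := by
    intro α β hlt heq
    have h1 := (he α).2
    have h2 : (H (Order.succ (α : Ordinal))).1 γ (e α) ≤ (H β).1 γ (e α) := by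
      rcases (Order.succ_le_of_lt (Subtype.coe_lt_coe.2 hlt)).eq_or_lt with h | h
      · rw [h]
      · exact (le_max_left _ _).trans (hH β β.2 ⟨_, h⟩ γ hγ (e α))
    have h3 := (he β).1
    rw [← heq] at h3
    exact absurd ((h1.trans h2).trans_lt h3) (lt_irrefl _)
  rcases lt_trichotomy α β with h | h | h
  · exact absurd hαβ (aux _ _ h)
  · exact h
  · exact absurd hαβ.symm (aux _ _ h)

/-- Passes from single ultrafilters to the filter: if `g` escapes every `f γ`, the decreasing sets
`{f γ < g}` extend to an ultrafilter on `Y` of cofinality exactly `maxCof a Y`, against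
universality. -/
theorem IsProgressiveFamily.exists_le_universalSeq (ha : IsProgressiveFamily a κ) {Y : Set ι}
    {f : Ordinal.{u} → CardProd a} (hf : IsUniversalSeq a (maxCof a Y) f)
    (hpos : 0 < (maxCof a Y).ord) (g : CardProd a) :
    ∃ γ < (maxCof a Y).ord,
      ∀ᶠ i in cofFilter a (maxCof a Y) ⊓ Filter.principal Y, g i ≤ f γ i := by
  by_contra! hno
  let L : Set.Iio (maxCof a Y).ord → Filter ι := fun γ =>
    cofFilter a (maxCof a Y) ⊓ Filter.principal Y ⊓ Filter.principal {i | f γ i < g i}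
  have hanti : ∀ γ δ : Set.Iio (maxCof a Y).ord, γ ≤ δ → L δ ≤ L γ := by
    intro γ δ hle
    rcases hle.eq_or_lt with rfl | hlt
    · exact le_rfl
    refine le_inf inf_le_left (Filter.le_principal_iff.2 ?_)
    have h1 : ∀ᶠ i in L δ, f γ i ≤ f δ i :=
      (inf_le_left.trans inf_le_left : L δ ≤ _) (hf.increasing δ δ.2 γ hlt)
    have h2 : ∀ᶠ i in L δ, f δ i < g i := (inf_le_right : L δ ≤ _) (Filter.mem_principal_self _)
    exact (h1.and h2).mono fun i hi => hi.1.trans_lt hi.2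
  have hdir : Directed (· ≥ ·) L := by
    intro γ δ
    rcases le_total γ δ with h | h
    · exact ⟨δ, hanti _ _ h, le_rfl⟩
    · exact ⟨γ, le_rfl, hanti _ _ h⟩
  have hI : Nonempty (Set.Iio (maxCof a Y).ord) := ⟨⟨0, hpos⟩⟩
  have hne : (⨅ γ, L γ).NeBot := by
    refine Filter.iInf_neBot_of_directed' hdir fun γ => ?_
    exact Filter.frequently_mem_iff_neBot.1 (hno γ γ.2)
  obtain ⟨D, hD⟩ := @Ultrafilter.exists_le _ _ hne
  have hle : ∀ γ, (D : Filter ι) ≤ L γ := fun γ => hD.trans (iInf_le _ γ)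
  have hDK := ((hle hI.some).trans inf_le_left).trans inf_le_left
  have hDY : Y ∈ D :=
    Filter.le_principal_iff.1 (((hle hI.some).trans inf_le_left).trans inf_le_right)
  have hcof : ultraCof a D = maxCof a Y :=
    (ha.ultraCof_le_maxCof hDY).antisymm (ha.le_ultraCof_of_le_cofFilter hDK)
  obtain ⟨γ, hγ, hle'⟩ := hf.cofinal D hcof g
  have h1 : ∀ᶠ i in (D : Filter ι), f γ i < g i :=
    Filter.le_principal_iff.1 ((hle ⟨γ, hγ⟩).trans inf_le_right)
  obtain ⟨i, h2, h3⟩ := (h1.and hle').exists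
  exact absurd h3 h2.not_ge

/-- This drop in max pcf makes the later descent well-founded, hence the maxima finite. -/
theorem IsProgressiveFamily.maxCof_lt_of_eventually_le (ha : IsProgressiveFamily a κ)
    {Y : Set ι} {f g : CardProd a}
    (hle : ∀ᶠ i in cofFilter a (maxCof a Y) ⊓ Filter.principal Y, g i ≤ f i)
    (hne : {i ∈ Y | f i < g i}.Nonempty) : maxCof a {i ∈ Y | f i < g i} < maxCof a Y := by
  obtain ⟨D, hD, hcof⟩ := ha.exists_ultraCof_eq_maxCof hne
  have hDY : Y ∈ D := Filter.mem_of_superset hD fun i hi => hi.1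
  rw [← hcof]
  refine (ha.ultraCof_le_maxCof hDY).lt_of_ne fun heq => ?_
  have hDK : (D : Filter ι) ≤ cofFilter a (maxCof a Y) ⊓ Filter.principal Y :=
    le_inf (heq ▸ le_cofFilter_ultraCof D) (Filter.le_principal_iff.2 hDY)
  have hmem : ∀ᶠ i in (D : Filter ι), i ∈ {i ∈ Y | f i < g i} := hD
  obtain ⟨i, h1, h2⟩ := (hmem.and (hDK hle)).exists
  exact absurd h1.2 h2.not_gt

end Universal

/-! ### Club bounds along normal sequences of ordinals. -/

/-- The least `x` such that `F ≤ x` on a closed unbounded subset of `γ`. -/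
noncomputable def clubBound (γ : Ordinal.{u}) (F : Ordinal.{u} → Ordinal.{u}) : Ordinal.{u} :=
  sInf {x | ∃ C : Set (Set.Iio γ), IsClub C ∧ ∀ c ∈ C, F c ≤ x}

section NormalSequence

variable {o : Ordinal.{u}} {p s : Ordinal.{u} → Ordinal.{u}}

theorem succ_max_le_of_eq_iSup
    (hp : ∀ ε < o, p ε = ⨆ δ : Set.Iio ε, Order.succ (max (p δ) (s δ)))
    {δ ε : Ordinal.{u}} (hδ : δ < ε) (hε : ε < o) : Order.succ (max (p δ) (s δ)) ≤ p ε := by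
  rw [hp ε hε]
  exact Ordinal.le_iSup (fun δ : Set.Iio ε => Order.succ (max (p δ) (s δ))) ⟨δ, hδ⟩

theorem lt_of_eq_iSup
    (hp : ∀ ε < o, p ε = ⨆ δ : Set.Iio ε, Order.succ (max (p δ) (s δ)))
    {δ ε : Ordinal.{u}} (hδ : δ < ε) (hε : ε < o) : p δ < p ε :=
  (le_max_left _ _).trans_lt (Order.succ_le_iff.1 (succ_max_le_of_eq_iSup hp hδ hε))

theorem lt_iSup_of_eq_iSup (ho : Order.IsSuccLimit o)
    (hp : ∀ ε < o, p ε = ⨆ δ : Set.Iio ε, Order.succ (max (p δ) (s δ)))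
    {ε : Ordinal.{u}} (hε : ε < o) : p ε < ⨆ ε : Set.Iio o, p ε :=
  (lt_of_eq_iSup hp (Order.lt_succ ε) (ho.succ_lt hε)).trans_le
    (Ordinal.le_iSup (fun ε : Set.Iio o => p ε) ⟨Order.succ ε, ho.succ_lt hε⟩)

theorem isClub_image_of_eq_iSup (ho : Order.IsSuccLimit o)
    (hp : ∀ ε < o, p ε = ⨆ δ : Set.Iio ε, Order.succ (max (p δ) (s δ)))
    {ε₀ : Ordinal.{u}} (hε₀ : ε₀ < o) :
    IsClub {c : Set.Iio (⨆ ε : Set.Iio o, p ε) | ∃ ε, ε₀ ≤ ε ∧ ε < o ∧ p ε = c} := by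
  have hmono : ∀ {δ ε : Ordinal.{u}}, δ < o → ε < o → p ε < p δ → ε < δ := by
    intro δ ε hδ hε hlt
    by_contra! hle
    rcases hle.eq_or_lt with rfl | h
    · exact absurd hlt (lt_irrefl _)
    · exact absurd (lt_of_eq_iSup hp h hε) hlt.not_gt
  constructor
  · intro d hd hne _ x hx
    have hex : ∃ ε, ε < o ∧ (x : Ordinal) ≤ p ε := by
      by_contra! hno
      exact absurd (Set.mem_Iio.1 x.2) (Ordinal.iSup_le fun ε : Set.Iio o => (hno ε ε.2).le).not_gt
    -- For the least `δ` with `x ≤ p δ`, earlier values lie strictly below `x`, hence below members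
    -- of `d`; so the supremum defining `p δ` is at most `x`.
    obtain ⟨δ, ⟨hδ, hxδ⟩, hmin⟩ :=
      WellFounded.has_min Ordinal.lt_wf {ε | ε < o ∧ (x : Ordinal) ≤ p ε} hex
    refine ⟨δ, ?_, hδ, ?_⟩
    · by_contra! hlt
      obtain ⟨c, hc⟩ := hne
      obtain ⟨ε, h1, h2, h3⟩ := hd hc
      have h4 : p ε ≤ x := by rw [h3]; exact Subtype.coe_le_coe.2 (hx.1 hc)
      exact absurd (lt_of_eq_iSup hp (hlt.trans_le h1) h2) (h4.trans hxδ).not_gt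
    · refine le_antisymm ?_ hxδ
      rw [hp δ hδ]
      refine Ordinal.iSup_le fun ε => ?_
      have hε : (ε : Ordinal) < o := lt_trans (Set.mem_Iio.1 ε.2) hδ
      have hlt : p ε < x := by
        by_contra! hle
        exact hmin ε ⟨hε, hle⟩ ε.2
      have hnot : (⟨p ε, lt_trans hlt x.2⟩ : Set.Iio (⨆ ε : Set.Iio o, p ε)) ∉ upperBounds d :=
        fun h => absurd (Subtype.coe_le_coe.2 (hx.2 h)) hlt.not_ge
      simp only [mem_upperBounds, not_forall, not_le] at hnot
      obtain ⟨c, hc, hlc⟩ := hnot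
      obtain ⟨ε', -, h2, h3⟩ := hd hc
      have hlc : p ε < p ε' := by rw [h3]; exact hlc
      refine (succ_max_le_of_eq_iSup hp (hmono h2 hε hlc) h2).trans ?_
      rw [h3]
      exact Subtype.coe_le_coe.2 (hx.1 hc)
  · intro x
    have hex : ∃ ε, ε < o ∧ (x : Ordinal) ≤ p ε := by
      by_contra! hno
      exact absurd (Set.mem_Iio.1 x.2) (Ordinal.iSup_le fun ε : Set.Iio o => (hno ε ε.2).le).not_gt
    obtain ⟨δ, hδ, hxδ⟩ := hex
    have hm : max δ ε₀ < o := max_lt hδ hε₀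
    refine ⟨⟨p (max δ ε₀), lt_iSup_of_eq_iSup ho hp hm⟩,
      ⟨max δ ε₀, le_max_right _ _, hm, rfl⟩, ?_⟩
    refine Subtype.coe_le_coe.1 (hxδ.trans ?_)
    rcases (le_max_left δ ε₀).eq_or_lt with h | h
    · exact (congrArg p h).le
    · exact (lt_of_eq_iSup hp h hm).le

theorem cof_iSup_of_eq_iSup (ho : Order.IsSuccLimit o)
    (hp : ∀ ε < o, p ε = ⨆ δ : Set.Iio ε, Order.succ (max (p δ) (s δ))) :
    (⨆ ε : Set.Iio o, p ε).cof = o.cof :=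
  Ordinal.cof_iSup_Iio (f := fun ε : Set.Iio o => p ε)
    (fun _ ε h => lt_of_eq_iSup hp h ε.2) ho.isSuccPrelimit

theorem clubBound_le_of_eq_iSup (ho : Order.IsSuccLimit o)
    (hp : ∀ ε < o, p ε = ⨆ δ : Set.Iio ε, Order.succ (max (p δ) (s δ)))
    {ε₀ x : Ordinal.{u}} (hε₀ : ε₀ < o) {F : Ordinal.{u} → Ordinal.{u}}
    (hF : ∀ ε, ε₀ ≤ ε → ε < o → F (p ε) ≤ x) :
    clubBound (⨆ ε : Set.Iio o, p ε) F ≤ x := by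
  refine csInf_le' ⟨_, isClub_image_of_eq_iSup ho hp hε₀, ?_⟩
  rintro c ⟨ε, h1, h2, h3⟩
  rw [← h3]
  exact hF ε h1 h2

/-- The supremum has cofinality `κ`, so fewer than `κ` clubs, one per coordinate, meet in a club;
one `ε` then serves all coordinates. Uncountability of `κ` is essential. -/
theorem exists_forall_le_clubBound {κ : Cardinal.{u}} (hκ : κ.IsRegular) (hκ' : ℵ₀ < κ)
    (hp : ∀ ε < κ.ord, p ε = ⨆ δ : Set.Iio ε, Order.succ (max (p δ) (s δ)))
    {ι : Type (u + 1)} (hι : #ι < Cardinal.lift.{u + 1} κ) {ε₀ ε₁ : Ordinal.{u}}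
    (hε₀ : ε₀ < κ.ord) (hε₁ : ε₁ < κ.ord) {F : ι → Ordinal.{u} → Ordinal.{u}}
    {g : ι → Ordinal.{u}} (hF : ∀ i ε, ε₀ ≤ ε → ε < κ.ord → F i (p ε) ≤ g i) :
    ∃ ε, ε₀ ≤ ε ∧ ε₁ < ε ∧ ε < κ.ord ∧
      ∀ i, F i (p ε) ≤ clubBound (⨆ ε : Set.Iio κ.ord, p ε) (F i) := by
  have ho : Order.IsSuccLimit κ.ord := Cardinal.isSuccLimit_ord hκ.aleph0_le
  have hclub := isClub_image_of_eq_iSup ho hp hε₀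
  have hmem : ∀ i, ∃ C : Set (Set.Iio (⨆ ε : Set.Iio κ.ord, p ε)), IsClub C ∧
      ∀ c ∈ C, F i c ≤ clubBound (⨆ ε : Set.Iio κ.ord, p ε) (F i) := by
    intro i
    refine csInf_mem (s := {x | ∃ C : Set (Set.Iio (⨆ ε : Set.Iio κ.ord, p ε)), IsClub C ∧
      ∀ c ∈ C, F i c ≤ x}) ⟨g i, _, hclub, ?_⟩
    rintro c ⟨ε, h1, h2, h3⟩
    rw [← h3]
    exact hF i ε h1 h2
  choose C hC hCF using hmem
  have hcof : Order.cof (Set.Iio (⨆ ε : Set.Iio κ.ord, p ε)) = Cardinal.lift.{u + 1} κ := by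
    rw [Ordinal.cof_Iio, ← Ordinal.lift_cof, cof_iSup_of_eq_iSup ho hp, hκ.cof_ord]
  have hne : Order.cof (Set.Iio (⨆ ε : Set.Iio κ.ord, p ε)) ≠ ℵ₀ := by
    rw [hcof]
    exact (Cardinal.aleph0_lt_lift.2 hκ').ne'
  have hint := (IsClub.iInter hne (by rw [hcof]; simpa using hι) hC).inter hne hclub
  have hs : Order.succ ε₁ < κ.ord := ho.succ_lt hε₁
  obtain ⟨c, ⟨hc, ε, h1, h2, h3⟩, hle⟩ :=
    hint.isCofinal ⟨p (Order.succ ε₁), lt_iSup_of_eq_iSup ho hp hs⟩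
  refine ⟨ε, h1, ?_, h2, fun i => ?_⟩
  · by_contra! hlt
    have h4 : p (Order.succ ε₁) ≤ p ε := by rw [h3]; exact Subtype.coe_le_coe.2 hle
    exact absurd (lt_of_eq_iSup hp (Order.lt_succ_iff.2 hlt) hs) h4.not_gt
  · rw [h3]
    exact hCF i c (Set.mem_iInter.1 hc i)

end NormalSequence

/-! ### Approximating functions by finitely many club bounds. -/

section Approximation

variable {ι : Type (u + 1)} {a : ι → Cardinal.{u}} {κ : Cardinal.{u}}

/-- One step of the approximation process: `x` continues the sequence `s` of triples consisting of a
function, a set of subsets of `ι`, and an ordinal for each subset of `ι`. -/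
structure IsApproxStep (f : Cardinal.{u} → Ordinal.{u} → CardProd a)
    (r : Set ι → CardProd a → Ordinal.{u}) (κ : Cardinal.{u}) (𝒴 : Set (Set ι)) (g : CardProd a)
    (ε : Ordinal.{u}) (s : Set.Iio ε → CardProd a × Set (Set ι) × (Set ι → Ordinal.{u}))
    (x : CardProd a × Set (Set ι) × (Set ι → Ordinal.{u})) : Prop where
  ge_init : ∀ i, g i ≤ x.1 i
  ge : ∀ δ i, (s δ).1 i ≤ x.1 i
  ge_seq : ∀ δ, ∀ Y ∈ (s δ).2.1, ∀ i, f (maxCof a Y) ((s δ).2.2 Y) i ≤ x.1 i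
  mk_le : #x.2.1 ≤ Cardinal.lift.{u + 1} κ
  init_subset : 𝒴 ⊆ x.2.1
  subset : ∀ δ, (s δ).2.1 ⊆ x.2.1
  mem : ∀ δ ε, ∀ Y ∈ (s ε).2.1,
    {i ∈ Y | f (maxCof a Y) ((s ε).2.2 Y) i < (s δ).1 i} ∈ x.2.1
  eq_iSup : ∀ Y, x.2.2 Y = ⨆ δ, Order.succ (max ((s δ).2.2 Y) (r Y (s δ).1))

theorem IsProgressiveFamily.exists_isApproxStep (ha : IsProgressiveFamily a κ)
    (f : Cardinal.{u} → Ordinal.{u} → CardProd a) (r : Set ι → CardProd a → Ordinal.{u})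
    {𝒴 : Set (Set ι)} (h𝒴 : #𝒴 ≤ Cardinal.lift.{u + 1} κ) (g : CardProd a) :
    ∃ s : Ordinal.{u} → CardProd a × Set (Set ι) × (Set ι → Ordinal.{u}),
      ∀ ε < κ.ord, IsApproxStep f r κ 𝒴 g ε (fun δ => s δ) (s ε) := by
  have hX : Nonempty (CardProd a × Set (Set ι) × (Set ι → Ordinal.{u})) := ⟨⟨g, ∅, fun _ => 0⟩⟩
  refine exists_transfinite κ.ord _ fun ε hε s ih => ?_
  have hinf : ℵ₀ ≤ Cardinal.lift.{u + 1} κ :=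
    Cardinal.aleph0_le_lift.2 ha.isRegular_bound.aleph0_le
  let T := Σ δ : Set.Iio ε, (s δ).2.1
  have hε' : #(Set.Iio ε) ≤ Cardinal.lift.{u + 1} κ := (mk_Iio_lt_lift hε).le
  have hT : #T ≤ Cardinal.lift.{u + 1} κ := by
    rw [Cardinal.mk_sigma]
    calc _ ≤ Cardinal.sum fun _ : Set.Iio ε => Cardinal.lift.{u + 1} κ :=
          Cardinal.sum_le_sum _ _ fun δ => (ih δ).mk_le
      _ ≤ _ := by
          rw [Cardinal.sum_const, Cardinal.lift_id, Cardinal.lift_id]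
          exact Cardinal.mul_le_of_le hinf hε' le_rfl
  obtain ⟨y, hy⟩ := ha.exists_gt (T := T ⊕ (Set.Iio ε ⊕ PUnit.{u + 2}))
    (by
      rw [Cardinal.mk_sum, Cardinal.mk_sum]
      simp only [Cardinal.lift_id]
      refine Cardinal.add_le_of_le hinf hT (Cardinal.add_le_of_le hinf hε' ?_)
      simpa using (ha.isRegular_bound.nat_lt 1).le)
    (Sum.elim (fun t => f (maxCof a t.2) ((s t.1).2.2 t.2))
      (Sum.elim (fun δ => (s δ).1) fun _ => g))
  let Z : Set (Set ι) := 𝒴 ∪ (Set.range (fun t : T => (t.2 : Set ι)) ∪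
    Set.range (fun t : T × Set.Iio ε =>
      {i ∈ (t.1.2 : Set ι) | f (maxCof a t.1.2) ((s t.1.1).2.2 t.1.2) i < (s t.2).1 i}))
  refine ⟨⟨y, Z, fun Y => ⨆ δ, Order.succ (max ((s δ).2.2 Y) (r Y (s δ).1))⟩, ?_, ?_, ?_, ?_, ?_,
    ?_, ?_, ?_⟩
  · exact fun i => (hy (Sum.inr (Sum.inr ⟨⟩)) i).le
  · exact fun δ i => (hy (Sum.inr (Sum.inl δ)) i).le
  · exact fun δ Y hY i => (hy (Sum.inl ⟨δ, Y, hY⟩) i).le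
  · refine (Cardinal.mk_union_le _ _).trans (Cardinal.add_le_of_le hinf h𝒴 ?_)
    refine (Cardinal.mk_union_le _ _).trans (Cardinal.add_le_of_le hinf ?_ ?_)
    · exact Cardinal.mk_range_le.trans hT
    · refine Cardinal.mk_range_le.trans ?_
      rw [Cardinal.mk_prod, Cardinal.lift_id, Cardinal.lift_id]
      exact Cardinal.mul_le_of_le hinf hT hε'
  · exact Set.subset_union_left
  · exact fun δ Y hY => Or.inr (Or.inl ⟨⟨δ, Y, hY⟩, rfl⟩)
  · exact fun δ ε Y hY => Or.inr (Or.inr ⟨⟨⟨ε, Y, hY⟩, δ⟩, rfl⟩)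
  · exact fun Y => rfl

/-- Every `g ∈ ∏ a` is dominated by a function whose restrictions to the members of a given small
family of subsets of `ι` are finite maxima of functions `clubBound γ (f l)`. -/
theorem IsProgressiveFamily.exists_ge_clubBound (ha : IsProgressiveFamily a κ) (hκ : ℵ₀ < κ)
    {f : Cardinal.{u} → Ordinal.{u} → CardProd a}
    (hf : ∀ l : Cardinal.{u}, l.IsRegular → κ < l → IsUniversalSeq a l (f l))
    {𝒴 : Set (Set ι)} (h𝒴 : #𝒴 ≤ Cardinal.lift.{u + 1} κ) (g : CardProd a) :
    ∃ h : CardProd a, (∀ i, g i ≤ h i) ∧ ∀ Y ∈ 𝒴, ∃ S : Set (Cardinal.{u} × Ordinal.{u}),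
      S.Finite ∧
      (∀ q ∈ S, q.1 ≤ maxCof a Y ∧ q.2 < q.1.ord ∧
        ∀ i, clubBound q.2 (fun c => f q.1 c i) ≤ h i) ∧
      ∀ i ∈ Y, ∃ q ∈ S, (h i : Ordinal) ≤ clubBound q.2 (fun c => f q.1 c i) := by
  have hreg : ∀ Y : Set ι, Y.Nonempty → (maxCof a Y).IsRegular ∧ κ < maxCof a Y := by
    intro Y hY
    obtain ⟨D, -, hD⟩ := ha.exists_ultraCof_eq_maxCof hY
    rw [← hD]
    exact ⟨ha.isRegular_ultraCof D, ha.lt_ultraCof D⟩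
  have hr : ∀ (Y : Set ι) (g : CardProd a), ∃ γ : Ordinal.{u}, Y.Nonempty →
      γ < (maxCof a Y).ord ∧ ∀ᶠ i in cofFilter a (maxCof a Y) ⊓ Filter.principal Y,
        g i ≤ f (maxCof a Y) γ i := by
    intro Y g
    by_cases hY : Y.Nonempty
    · obtain ⟨h1, h2⟩ := hreg Y hY
      obtain ⟨γ, hγ⟩ := ha.exists_le_universalSeq (hf _ h1 h2) h1.ord_pos g
      exact ⟨γ, fun _ => hγ⟩
    · exact ⟨0, fun h => absurd h hY⟩
  choose r hr using hr
  obtain ⟨s, hs⟩ := ha.exists_isApproxStep f r h𝒴 g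
  have ho : Order.IsSuccLimit κ.ord := Cardinal.isSuccLimit_ord ha.isRegular_bound.aleph0_le
  have hp : ∀ Y, ∀ ε < κ.ord, (s ε).2.2 Y =
      ⨆ δ : Set.Iio ε, Order.succ (max ((s δ).2.2 Y) (r Y (s δ).1)) :=
    fun Y ε hε => (hs ε hε).eq_iSup Y
  have hmono : ∀ {δ ε : Ordinal.{u}}, δ ≤ ε → ε < κ.ord → ∀ i, (s δ).1 i ≤ (s ε).1 i := by
    intro δ ε hle hε i
    rcases hle.eq_or_lt with rfl | h
    · exact le_rfl
    · exact (hs ε hε).ge ⟨δ, h⟩ i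
  have hsub : ∀ {δ ε : Ordinal.{u}}, δ ≤ ε → ε < κ.ord → (s δ).2.1 ⊆ (s ε).2.1 := by
    intro δ ε hle hε
    rcases hle.eq_or_lt with rfl | h
    · exact le_rfl
    · exact (hs ε hε).subset ⟨δ, h⟩
  have hbound : ∀ i, (⨆ ε : Set.Iio κ.ord, ((s ε).1 i : Ordinal)) < (a i).ord := by
    intro i
    obtain ⟨b, hb, hlt⟩ := exists_lt_ord_of_mk_lt (ha.isRegular i) (T := Set.Iio κ.ord)
      (by simpa using ha.bound_lt i) (fun ε => ((s ε).1 i : Ordinal)) (fun ε => ((s ε).1 i).2)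
    exact (Ordinal.iSup_le fun ε => (hlt ε).le).trans_lt hb
  let h : CardProd a := fun i => ⟨⨆ ε : Set.Iio κ.ord, ((s ε).1 i : Ordinal), hbound i⟩
  have hh : ∀ ε < κ.ord, ∀ i, (s ε).1 i ≤ h i := fun ε hε i =>
    Subtype.coe_le_coe.1 (Ordinal.le_iSup (fun ε : Set.Iio κ.ord => ((s ε).1 i : Ordinal)) ⟨ε, hε⟩)
  have hplt : ∀ Y : Set ι, Y.Nonempty →
      (⨆ ε : Set.Iio κ.ord, (s ε).2.2 Y) < (maxCof a Y).ord := by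
    intro Y hY
    obtain ⟨h1, h2⟩ := hreg Y hY
    have hlim := Cardinal.isSuccLimit_ord h1.aleph0_le
    have hlt : ∀ ε < κ.ord, (s ε).2.2 Y < (maxCof a Y).ord := by
      intro ε
      induction ε using WellFoundedLT.induction with
      | ind ε ih =>
        intro hε
        obtain ⟨b, hb, hlt⟩ := exists_lt_ord_of_mk_lt h1 (T := Set.Iio ε)
          ((mk_Iio_lt_lift hε).trans (Cardinal.lift_lt.2 h2))
          (fun δ => Order.succ (max ((s δ).2.2 Y) (r Y (s δ).1)))
          (fun δ => hlim.succ_lt (max_lt (ih δ δ.2 (lt_trans (Set.mem_Iio.1 δ.2) hε))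
            (hr Y _ hY).1))
        rw [hp Y ε hε]
        exact (Ordinal.iSup_le fun δ => (hlt δ).le).trans_lt hb
    obtain ⟨b, hb, hlt'⟩ := exists_lt_ord_of_mk_lt h1 (T := Set.Iio κ.ord)
      (by simpa using h2) (fun ε => (s ε).2.2 Y) (fun ε => hlt ε ε.2)
    exact (Ordinal.iSup_le fun ε => (hlt' ε).le).trans_lt hb
  have main : ∀ c : Cardinal.{u}, ∀ ε₀ < κ.ord, ∀ Y ∈ (s ε₀).2.1, maxCof a Y = c →
      ∃ S : Set (Cardinal.{u} × Ordinal.{u}), S.Finite ∧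
        (∀ q ∈ S, q.1 ≤ maxCof a Y ∧ q.2 < q.1.ord ∧
          ∀ i, clubBound q.2 (fun c => f q.1 c i) ≤ h i) ∧
        ∀ i ∈ Y, ∃ q ∈ S, (h i : Ordinal) ≤ clubBound q.2 (fun c => f q.1 c i) := by
    -- Induction on max pcf: one club bound at `Y` is correct except on a set `Y'` already in the
    -- family, whose max pcf is smaller.
    intro c
    induction c using WellFoundedLT.induction with
    | ind c ih =>
      intro ε₀ hε₀ Y hY hc
      rcases Y.eq_empty_or_nonempty with rfl | hne
      · exact ⟨∅, Set.finite_empty, by simp, by simp⟩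
      obtain ⟨h1, h2⟩ := hreg Y hne
      let γ := ⨆ ε : Set.Iio κ.ord, (s ε).2.2 Y
      let H : ι → Ordinal.{u} := fun i => clubBound γ (fun c => f (maxCof a Y) c i)
      have hseq : ∀ i ε, ε₀ ≤ ε → ε < κ.ord → (f (maxCof a Y) ((s ε).2.2 Y) i : Ordinal) ≤ h i := by
        intro i ε hle hε
        have hsε := ho.succ_lt hε
        exact Subtype.coe_le_coe.2 (((hs _ hsε).ge_seq ⟨ε, Set.mem_Iio.2 (Order.lt_succ ε)⟩ Y
          (hsub hle hε hY) i).trans (hh _ hsε i))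
      have hHle : ∀ i, H i ≤ h i := fun i =>
        clubBound_le_of_eq_iSup (p := fun ε => (s ε).2.2 Y) (s := fun ε => r Y (s ε).1)
          ho (hp Y) hε₀ (F := fun c => f (maxCof a Y) c i) (hseq i)
      have hex : ∀ i, ∃ ε, ε < κ.ord ∧ (H i < h i → H i < (s ε).1 i) := by
        intro i
        by_cases hi : H i < h i
        · obtain ⟨ε, hε⟩ := (Ordinal.lt_iSup_iff).1 hi
          exact ⟨ε, ε.2, fun _ => hε⟩
        · exact ⟨0, ha.isRegular_bound.ord_pos, fun h => absurd h hi⟩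
      choose e he heH using hex
      -- By stage `ε₁` the approximation exceeds `H` wherever `h` does; at stage `ε₂ > ε₁` the
      -- universal sequence is at most `H` everywhere. So `Y'` catches every coordinate of `Y` with
      -- `H i < h i`.
      obtain ⟨ε₁, hε₁, hlt⟩ := exists_lt_ord_of_mk_lt ha.isRegular_bound ha.mk_lt e he
      obtain ⟨ε₂, h3, h4, h5, h6⟩ := exists_forall_le_clubBound
        (p := fun ε => (s ε).2.2 Y) (s := fun ε => r Y (s ε).1) ha.isRegular_bound hκ (hp Y)
        ha.mk_lt hε₀ hε₁ (F := fun i c => f (maxCof a Y) c i) hseq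
      let Y' : Set ι := {i ∈ Y | f (maxCof a Y) ((s ε₂).2.2 Y) i < (s ε₁).1 i}
      have hsε := ho.succ_lt h5
      have hY' : Y' ∈ (s (Order.succ ε₂)).2.1 :=
        (hs _ hsε).mem ⟨ε₁, Set.mem_Iio.2 (h4.trans (Order.lt_succ ε₂))⟩
          ⟨ε₂, Set.mem_Iio.2 (Order.lt_succ ε₂)⟩ Y (hsub h3 h5 hY)
      have hsubY : ∀ i ∈ Y, H i < h i → i ∈ Y' := fun i hi hlt' =>
        ⟨hi, Subtype.coe_lt_coe.1 ((h6 i).trans_lt ((heH i hlt').trans_le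
          (Subtype.coe_le_coe.2 (hmono (hlt i).le hε₁ i))))⟩
      have hS' : ∃ S : Set (Cardinal.{u} × Ordinal.{u}), S.Finite ∧
          (∀ q ∈ S, q.1 ≤ maxCof a Y ∧ q.2 < q.1.ord ∧
            ∀ i, clubBound q.2 (fun c => f q.1 c i) ≤ h i) ∧
          ∀ i ∈ Y', ∃ q ∈ S, (h i : Ordinal) ≤ clubBound q.2 (fun c => f q.1 c i) := by
        rcases Y'.eq_empty_or_nonempty with hemp | hne'
        · exact ⟨∅, Set.finite_empty, by simp, by simp [hemp]⟩
        have hlt' : maxCof a Y' < maxCof a Y := by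
          refine ha.maxCof_lt_of_eventually_le ?_ hne'
          have h7 := (hr Y (s ε₁).1 hne).2
          have h8 : r Y (s ε₁).1 < (s ε₂).2.2 Y :=
            (le_max_right _ _).trans_lt (Order.succ_le_iff.1 (succ_max_le_of_eq_iSup
              (p := fun ε => (s ε).2.2 Y) (s := fun ε => r Y (s ε).1) (hp Y) h4 h5))
          have h9 : (s ε₂).2.2 Y < (maxCof a Y).ord :=
            (lt_iSup_of_eq_iSup (p := fun ε => (s ε).2.2 Y) (s := fun ε => r Y (s ε).1)
              ho (hp Y) h5).trans (hplt Y hne)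
          have h10 : ∀ᶠ i in cofFilter a (maxCof a Y) ⊓ Filter.principal Y,
              f (maxCof a Y) (r Y (s ε₁).1) i ≤ f (maxCof a Y) ((s ε₂).2.2 Y) i :=
            (inf_le_left : cofFilter a (maxCof a Y) ⊓ Filter.principal Y ≤ _)
              ((hf _ h1 h2).increasing _ h9 _ h8)
          filter_upwards [h7, h10] with i h11 h12
          exact h11.trans h12
        obtain ⟨S, hS1, hS2, hS3⟩ := ih _ (hc ▸ hlt') _ hsε Y' hY' rfl
        exact ⟨S, hS1, fun q hq => ⟨(hS2 q hq).1.trans hlt'.le, (hS2 q hq).2⟩, hS3⟩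
      obtain ⟨S, hS1, hS2, hS3⟩ := hS'
      refine ⟨insert (maxCof a Y, γ) S, hS1.insert _, ?_, ?_⟩
      · rintro q (rfl | hq)
        · exact ⟨le_rfl, hplt Y hne, hHle⟩
        · exact hS2 q hq
      · intro i hi
        rcases lt_or_ge (H i) (h i) with hlt' | hge
        · obtain ⟨q, hq, hle⟩ := hS3 i (hsubY i hi hlt')
          exact ⟨q, Or.inr hq, hle⟩
        · exact ⟨_, Or.inl rfl, hge⟩
  have h0 := ha.isRegular_bound.ord_pos
  exact ⟨h, fun i => ((hs 0 h0).ge_init i).trans (hh 0 h0 i),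
    fun Y hY => main _ 0 h0 Y ((hs 0 h0).init_subset hY) rfl⟩

end Approximation

/-! ### Separating rows of an array, and the last-failure coloring. -/

section Coloring

variable {θ ν : Cardinal.{u}} {a : Set.Iio θ.ord → Cardinal.{u}}
  {f : Set.Iio ν.ord → CardProd a}

theorem exists_gt_Iio_ord {c : Cardinal.{u}} (hc : c.IsRegular) (i : Set.Iio c.ord) :
    ∃ j : Set.Iio c.ord, i < j :=
  ⟨⟨Order.succ i, (Cardinal.isSuccLimit_ord hc.aleph0_le).succ_lt i.2⟩,
    Subtype.coe_lt_coe.1 (Order.lt_succ (i : Ordinal))⟩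

theorem ltMod_boundedIdeal_iff (hθ : θ.IsRegular) {g h : CardProd a} :
    LtMod (boundedIdeal (Set.Iio θ.ord)) g h ↔ ∃ i, ∀ j, i ≤ j → g j < h j := by
  constructor
  · rintro ⟨b, hb⟩
    obtain ⟨i, hi⟩ := exists_gt_Iio_ord hθ b
    refine ⟨i, fun j hj => ?_⟩
    by_contra hlt
    exact absurd (hb hlt) (hi.trans_le hj).not_ge
  · rintro ⟨i, hi⟩
    refine ⟨i, fun j hj => ?_⟩
    by_contra! hlt
    exact hj (hi j hlt.le)

theorem IsScale.lt_length (hθ : θ.IsRegular) (ha : StrictMono a) (hreg : ∀ i, (a i).IsRegular)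
    (hf : IsScale a (boundedIdeal (Set.Iio θ.ord)) ν f) (i : Set.Iio θ.ord) : a i < ν := by
  by_contra! hle
  have hex : ∀ k, ∃ x : Set.Iio (a k).ord, i < k → ∀ α, f α k < x := by
    intro k
    by_cases hk : i < k
    · obtain ⟨b, hb, hlt⟩ := exists_lt_ord_of_mk_lt (hreg k) (T := Set.Iio ν.ord)
        (by simpa using hle.trans_lt (ha hk)) (fun α => (f α k : Ordinal)) (fun α => (f α k).2)
      exact ⟨⟨b, hb⟩, fun _ => hlt⟩
    · exact ⟨⟨0, (hreg k).ord_pos⟩, fun h => absurd h hk⟩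
  choose g hg using hex
  obtain ⟨α, hα⟩ := hf.cofinal g
  obtain ⟨j, hj⟩ := (ltMod_boundedIdeal_iff hθ).1 hα
  obtain ⟨k, hk⟩ := exists_gt_Iio_ord hθ (max i j)
  exact absurd (hg k ((le_max_left _ _).trans_lt hk) α)
    (hj k ((le_max_right _ _).trans_lt hk).le).not_gt

/-- Disjointness lets fewer than `ν` rows meet an initial segment; since a row has fewer than `θ`
entries, its tails have a common start. -/
theorem IsScale.exists_row_gt (hθ : θ.IsRegular) (hν : ν.IsRegular)
    (hf : IsScale a (boundedIdeal (Set.Iio θ.ord)) ν f) {ξ : Ordinal.{u}} (hξ : ξ < θ.ord)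
    {t : Set.Iio ν.ord → Set.Iio ξ → Set.Iio ν.ord}
    (ht : ∀ α β, α ≠ β → Disjoint (Set.range (t α)) (Set.range (t β)))
    (χ : CardProd a) (γ : Set.Iio ν.ord) :
    ∃ β, γ < β ∧ (∀ ζ, γ < t β ζ) ∧ ∃ i, ∀ j, i ≤ j → ∀ ζ, χ j < f (t β ζ) j := by
  obtain ⟨α, hα⟩ := hf.cofinal χ
  let δ := max γ α
  let T := {β : Set.Iio ν.ord // ∃ ζ, t β ζ ≤ δ}
  have hT : #T < Cardinal.lift.{u + 1} ν := by
    choose ζ hζ using fun β : T => β.2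
    have hlim := Cardinal.isSuccLimit_ord hν.aleph0_le
    refine (Cardinal.mk_le_of_injective (β := Set.Iio (Order.succ (δ : Ordinal)))
      (f := fun β : T => ⟨t β.1 (ζ β), Set.mem_Iio.2 (Order.lt_succ_iff.2
        (Subtype.coe_le_coe.2 (hζ β)))⟩) ?_).trans_lt (mk_Iio_lt_lift (hlim.succ_lt δ.2))
    intro β β' heq
    by_contra hne
    have hne' : β.1 ≠ β'.1 := fun h => hne (Subtype.ext h)
    have h1 : t β.1 (ζ β) = t β'.1 (ζ β') := by
      simpa only [Subtype.mk.injEq, ← Subtype.ext_iff] using heq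
    exact Set.disjoint_left.1 (ht _ _ hne') ⟨_, rfl⟩ ⟨_, h1.symm⟩
  obtain ⟨b, hb, hlt⟩ := exists_lt_ord_of_mk_lt hν hT (fun β => (β.1 : Ordinal)) (fun β => β.1.2)
  obtain ⟨β, hβ⟩ := exists_gt_Iio_ord hν (max γ ⟨b, hb⟩)
  have hβt : ∀ ζ, δ < t β ζ := by
    intro ζ
    by_contra! hle
    have h1 : β < ⟨b, hb⟩ := hlt ⟨β, ζ, hle⟩
    exact absurd h1 ((le_max_right _ _).trans_lt hβ).not_gt
  refine ⟨β, (le_max_left _ _).trans_lt hβ, fun ζ => (le_max_left _ _).trans_lt (hβt ζ), ?_⟩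
  obtain ⟨i, hi⟩ := (ltMod_boundedIdeal_iff hθ).1 hα
  choose k hk using fun ζ => (ltMod_boundedIdeal_iff hθ).1
    (hf.increasing α (t β ζ) ((le_max_right _ _).trans_lt (hβt ζ)))
  obtain ⟨m, hm, hkm⟩ := exists_lt_ord_of_mk_lt hθ (mk_Iio_lt_lift hξ) (fun ζ => (k ζ : Ordinal))
    (fun ζ => (k ζ).2)
  refine ⟨max i ⟨m, hm⟩, fun j hj ζ => (hi j ((le_max_left _ _).trans hj)).trans (hk ζ j ?_)⟩
  have h1 : k ζ < ⟨m, hm⟩ := hkm ζ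
  exact h1.le.trans ((le_max_right _ _).trans hj)

/-- Otherwise each `i₀` has a counterexample `p i₀`. These `θ` functions have a common bound `χ` on
a tail, and a row above `χ` from `i₁` on refutes the counterexample at `max i₁ i₂`. -/
theorem IsScale.exists_rows_ge (hθ : θ.IsRegular) (hν : ν.IsRegular) (ha : StrictMono a)
    (hreg : ∀ i, (a i).IsRegular)
    (hf : IsScale a (boundedIdeal (Set.Iio θ.ord)) ν f) {ξ : Ordinal.{u}} (hξ : ξ < θ.ord)
    {t : Set.Iio ν.ord → Set.Iio ξ → Set.Iio ν.ord}
    (ht : ∀ α β, α ≠ β → Disjoint (Set.range (t α)) (Set.range (t β)))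
    {i₂ : Set.Iio θ.ord} (hi₂ : θ < a i₂) (U : Set.Iio θ.ord → Set (Set.Iio θ.ord)) :
    ∃ i₀, i₂ ≤ i₀ ∧ ∀ i, i₀ ≤ i → ∀ p : CardProd a,
      ∃ α, ∀ k ∈ U i, i₀ ≤ k → k ≤ i → ∀ ζ, p k ≤ f (t α ζ) k := by
  by_contra! hno
  have hex : ∀ i₀, ∃ i, ∃ p : CardProd a, i₂ ≤ i₀ → i₀ ≤ i ∧
      ∀ α, ∃ k ∈ U i, i₀ ≤ k ∧ k ≤ i ∧ ∃ ζ, f (t α ζ) k < p k := by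
    intro i₀
    by_cases h : i₂ ≤ i₀
    · obtain ⟨i, hi, p, hp⟩ := hno i₀ h
      exact ⟨i, p, fun _ => ⟨hi, hp⟩⟩
    · exact ⟨i₀, fun k => ⟨0, (hreg k).ord_pos⟩, fun h' => absurd h' h⟩
  choose i p hp using hex
  have hχ : ∀ j, ∃ x : Set.Iio (a j).ord, i₂ ≤ j → ∀ i₀, p i₀ j < x := by
    intro j
    by_cases hj : i₂ ≤ j
    · obtain ⟨b, hb, hlt⟩ := exists_lt_ord_of_mk_lt (hreg j) (T := Set.Iio θ.ord)
        (by simpa using hi₂.trans_le (ha.monotone hj)) (fun i₀ => (p i₀ j : Ordinal))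
        (fun i₀ => (p i₀ j).2)
      exact ⟨⟨b, hb⟩, fun _ => hlt⟩
    · exact ⟨⟨0, (hreg j).ord_pos⟩, fun h => absurd h hj⟩
  choose χ hχ using hχ
  obtain ⟨β, -, -, i₁, hi₁⟩ := hf.exists_row_gt hθ hν hξ ht χ ⟨0, hν.ord_pos⟩
  obtain ⟨k, hk, h1, -, ζ, hlt⟩ := (hp (max i₁ i₂) (le_max_right _ _)).2 β
  exact absurd (hlt.trans (hχ k ((le_max_right _ _).trans h1) _))
    (hi₁ k ((le_max_left _ _).trans h1) ζ).not_gt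

/-- For `i` in an unbounded set, there are rows `t_α`, `t_β` with `α < β` such that the functions of
the second row are dominated by those of the first on a tail of `L i`, and dominate them on `U i`,
provided that there are few restrictions to `L i` of bounds for the rows. -/
theorem IsScale.exists_separated_rows (hθ : θ.IsRegular) (hν : ν.IsRegular) (ha : StrictMono a)
    (hreg : ∀ i, (a i).IsRegular)
    (hf : IsScale a (boundedIdeal (Set.Iio θ.ord)) ν f) {ξ : Ordinal.{u}} (hξ : ξ < θ.ord)
    {t : Set.Iio ν.ord → Set.Iio ξ → Set.Iio ν.ord}
    (ht : ∀ α β, α ≠ β → Disjoint (Set.range (t α)) (Set.range (t β)))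
    {i₂ : Set.Iio θ.ord} (hi₂ : θ < a i₂) {L U : Set.Iio θ.ord → Set (Set.Iio θ.ord)}
    (hL : ∀ i, L i ⊆ Set.Iic i) (hUne : ∀ i, (U i).Nonempty) (hU : ∀ i, U i ⊆ Set.Ici i)
    {M : Set.Iio ν.ord → CardProd a} (hM : ∀ β ζ j, i₂ ≤ j → f (t β ζ) j ≤ M β j)
    (htypes : ∀ i, ∀ j ∈ U i,
      #(Set.range fun β => fun k : L i => M β k) < Cardinal.lift.{u + 1} (a j)) :
    ∃ i₀, ∀ S : Set (Set.Iio θ.ord), ¬ BddAbove S → ∃ i ∈ S, i₀ < i ∧ ∃ α β, α < β ∧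
      (∀ ζ η, t α ζ < t β η) ∧
      (∀ ζ η, ∀ k ∈ L i, i₀ ≤ k → f (t β η) k ≤ f (t α ζ) k) ∧
      ∀ ζ η, ∀ j ∈ U i, f (t α ζ) j < f (t β η) j := by
  obtain ⟨i₀, hi₀, hA⟩ := hf.exists_rows_ge hθ hν ha hreg hξ ht hi₂ L
  have hlt := hf.lt_length hθ ha hreg
  have hθν : θ < ν := hi₂.trans (hlt i₂)
  have hA' : ∀ i, ∀ q : Set.range (fun β => fun k : L i => M β k), ∃ α, i₀ ≤ i →
      ∀ k : L i, i₀ ≤ k → ∀ ζ, q.1 k ≤ f (t α ζ) k := by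
    rintro i ⟨_, β, rfl⟩
    by_cases hi : i₀ ≤ i
    · obtain ⟨α, hα⟩ := hA i hi (M β)
      exact ⟨α, fun _ k hk => hα k k.2 hk (hL i k.2)⟩
    · exact ⟨β, fun h => absurd h hi⟩
  choose A hA' using hA'
  -- The chosen rows lie below one `b`, so a row beyond `b` comes after all of them, whichever `i`
  -- is used later.
  have hb : ∃ b : Set.Iio ν.ord, ∀ i q, A i q < b ∧ ∀ ζ, t (A i q) ζ < b := by
    have h1 : ∀ i q, ∃ b < ν.ord, ∀ ζ, (t (A i q) ζ : Ordinal) < b := fun i q =>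
      exists_lt_ord_of_mk_lt hν ((mk_Iio_lt_lift hξ).trans (Cardinal.lift_lt.2 hθν)) _
        (fun ζ => (t (A i q) ζ).2)
    choose b₁ hb₁ hlt₁ using h1
    have h2 : ∀ i, ∃ b < ν.ord, ∀ q, max (A i q : Ordinal) (b₁ i q) < b := by
      intro i
      obtain ⟨j, hj⟩ := hUne i
      exact exists_lt_ord_of_mk_lt hν ((htypes i j hj).trans (Cardinal.lift_lt.2 (hlt j))) _
        (fun q => max_lt (A i q).2 (hb₁ i q))
    choose b₂ hb₂ hlt₂ using h2
    obtain ⟨b, hb, hlt₃⟩ := exists_lt_ord_of_mk_lt hν (T := Set.Iio θ.ord) (by simpa using hθν)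
      b₂ hb₂
    refine ⟨⟨b, hb⟩, fun i q => ⟨?_, fun ζ => ?_⟩⟩
    · exact Subtype.coe_lt_coe.1 (((le_max_left _ _).trans_lt (hlt₂ i q)).trans (hlt₃ i))
    · exact Subtype.coe_lt_coe.1
        ((hlt₁ i q ζ).trans (((le_max_right _ _).trans_lt (hlt₂ i q)).trans (hlt₃ i)))
  obtain ⟨b, hb⟩ := hb
  have hχ : ∀ j, ∃ x : Set.Iio (a j).ord, i₀ ≤ j → ∀ i q, j ∈ U i → M (A i q) j < x := by
    intro j
    by_cases hj : i₀ ≤ j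
    · have h1 : ∀ i, ∃ y < (a j).ord, ∀ q, j ∈ U i → (M (A i q) j : Ordinal) < y := by
        intro i
        by_cases hi : j ∈ U i
        · obtain ⟨y, hy, hly⟩ := exists_lt_ord_of_mk_lt (hreg j) (htypes i j hi)
            (fun q => (M (A i q) j : Ordinal)) (fun q => (M (A i q) j).2)
          exact ⟨y, hy, fun q _ => hly q⟩
        · exact ⟨0, (hreg j).ord_pos, fun q h => absurd h hi⟩
      choose y hy hly using h1
      obtain ⟨x, hx, hlx⟩ := exists_lt_ord_of_mk_lt (hreg j) (T := Set.Iio θ.ord)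
        (by simpa using hi₂.trans_le (ha.monotone (hi₀.trans hj))) y hy
      exact ⟨⟨x, hx⟩, fun _ i q hi => Subtype.coe_lt_coe.1 ((hly i q hi).trans (hlx i))⟩
    · exact ⟨⟨0, (hreg j).ord_pos⟩, fun h => absurd h hj⟩
  choose χ hχ using hχ
  obtain ⟨β, hβ, htβ, i₁, hi₁⟩ := hf.exists_row_gt hθ hν hξ ht χ b
  refine ⟨i₀, fun S hS => ?_⟩
  obtain ⟨i, hiS, hi⟩ := not_bddAbove_iff.1 hS (max i₀ i₁)
  have hi0 : i₀ < i := (le_max_left _ _).trans_lt hi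
  have hi1 : i₁ < i := (le_max_right _ _).trans_lt hi
  let q : Set.range (fun β => fun k : L i => M β k) := ⟨_, β, rfl⟩
  refine ⟨i, hiS, hi0, A i q, β, (hb i q).1.trans hβ, fun ζ η => ((hb i q).2 ζ).trans (htβ η),
    fun ζ η k hk hle => ?_, fun ζ η j hj => ?_⟩
  · exact (hM β η k (hi₀.trans hle)).trans (hA' i q hi0.le ⟨k, hk⟩ hle ζ)
  · have hij : i ≤ j := hU i hj
    exact ((hM _ ζ j (hi₀.trans (hi0.le.trans hij))).trans_lt
      (hχ j (hi0.le.trans hij) i q hj)).trans (hi₁ j (hi1.le.trans hij) η)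

/-- The bound at `j` is a function of the row's values at `j` alone, so counting restrictions of
rows also counts restrictions of bounds. -/
theorem exists_row_bound (ha : StrictMono a) (hreg : ∀ i, (a i).IsRegular) {ξ : Ordinal.{u}}
    (hξ : ξ < θ.ord) {i₂ : Set.Iio θ.ord} (hi₂ : θ < a i₂) :
    ∃ m : ∀ j, (Set.Iio ξ → Set.Iio (a j).ord) → Set.Iio (a j).ord,
      ∀ j, i₂ ≤ j → ∀ s ζ, s ζ ≤ m j s := by
  have hex : ∀ j, ∀ s : Set.Iio ξ → Set.Iio (a j).ord, ∃ x : Set.Iio (a j).ord,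
      i₂ ≤ j → ∀ ζ, s ζ ≤ x := by
    intro j s
    by_cases hj : i₂ ≤ j
    · obtain ⟨b, hb, hlt⟩ := exists_lt_ord_of_mk_lt (hreg j)
        ((mk_Iio_lt_lift hξ).trans (Cardinal.lift_lt.2 (hi₂.trans_le (ha.monotone hj))))
        (fun ζ => (s ζ : Ordinal)) (fun ζ => (s ζ).2)
      exact ⟨⟨b, hb⟩, fun _ ζ => (hlt ζ).le⟩
    · exact ⟨⟨0, (hreg j).ord_pos⟩, fun h => absurd h hj⟩
  choose m hm using hex
  exact ⟨m, fun j hj s ζ => hm j s hj ζ⟩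

theorem IsPositivePartition.exists_coloring {κ : Cardinal.{u}} (hθ : θ.IsRegular)
    {J : Set (Set (Set.Iio θ.ord))} {A : Set.Iio κ.ord → Set Cardinal.{u}}
    (hA : IsPositivePartition a J κ A)
    (S : Set.Iio ν.ord → Set.Iio ν.ord → Set (Set.Iio θ.ord))
    (hS : ∀ α β, α < β → (S α β).Nonempty) :
    ∃ c : Sym2 (Set.Iio ν.ord) → Set.Iio κ.ord, ∀ α β, α < β → ∀ l, c s(α, β) = l ↔
      ∃ i, IsLeast (S α β) i ∧ a i ∈ A l := by
  have hpiece : ∀ i, ∃ l, a i ∈ A l := fun i =>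
    Set.mem_iUnion.1 (hA.union ▸ Set.mem_range_self i)
  have hex : ∀ α β, ∃ l, α < β → ∃ i, IsLeast (S α β) i ∧ a i ∈ A l := by
    intro α β
    by_cases h : α < β
    · obtain ⟨i, hi, hmin⟩ := WellFounded.has_min (wellFounded_lt (α := Set.Iio θ.ord)) _ (hS α β h)
      obtain ⟨l, hl⟩ := hpiece i
      exact ⟨l, fun _ => ⟨i, ⟨hi, fun j hj => not_lt.1 (hmin j hj)⟩, hl⟩⟩
    · obtain ⟨l, -⟩ := hpiece ⟨0, hθ.ord_pos⟩
      exact ⟨l, fun h' => absurd h' h⟩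
  choose col hcol using hex
  refine ⟨Sym2.lift ⟨fun x y => col (min x y) (max x y), fun x y => by
    simp only [min_comm x y, max_comm x y]⟩, fun α β h l => ?_⟩
  simp only [Sym2.lift_mk, min_eq_left h.le, max_eq_right h.le]
  constructor
  · rintro rfl
    exact hcol α β h
  · rintro ⟨i, hi, hl⟩
    obtain ⟨i', hi', hl'⟩ := hcol α β h
    rw [hi'.unique hi] at hl'
    by_contra hne
    exact Set.disjoint_left.1 (hA.disjoint _ _ hne) hl' hl

theorem IsScale.exists_lastFailureColoring (hθ : θ.IsRegular) (hν : ν.IsRegular)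
    (ha : StrictMono a) (hreg : ∀ i, (a i).IsRegular) (hθa : ∃ i, θ < a i)
    (hf : IsScale a (boundedIdeal (Set.Iio θ.ord)) ν f) {ρ : Cardinal.{u}}
    {B : Set.Iio ρ.ord → Set Cardinal.{u}}
    (hB : IsPositivePartition a (boundedIdeal (Set.Iio θ.ord)) ρ B) :
    ∃ c, IsLastFailureColoring a ν ρ f B c ∧ WitnessesPr1 ν ν ρ θ c := by
  obtain ⟨c, hc⟩ := hB.exists_coloring (ν := ν) hθ (fun α β => upperBounds {j | f β j ≤ f α j})
    (fun α β h => by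
      obtain ⟨b, hb⟩ := hf.increasing α β h
      exact ⟨b, fun j hj => hb hj.not_gt⟩)
  refine ⟨c, hc, fun ξ hξ t ht γ => ?_⟩
  obtain ⟨i₂, hi₂⟩ := hθa
  obtain ⟨m, hm⟩ := exists_row_bound ha hreg hξ hi₂
  obtain ⟨i₀, hsep⟩ := hf.exists_separated_rows hθ hν ha hreg hξ ht hi₂
    (L := fun i => {i}) (U := fun i => Set.Ioi i) (fun i k hk => (Set.mem_singleton_iff.1 hk).le)
    (fun i => exists_gt_Iio_ord hθ i) (fun i => Set.Ioi_subset_Ici_self)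
    (M := fun β j => m j fun ζ => f (t β ζ) j)
    (fun β ζ j hj => hm j hj (fun ζ => f (t β ζ) j) ζ)
    (fun i j hj => by
      refine lt_of_le_of_lt (b := Cardinal.lift.{u + 1} (a i)) ?_ (Cardinal.lift_lt.2 (ha hj))
      have h1 : #(∀ k : ({i} : Set (Set.Iio θ.ord)), Set.Iio (a k).ord) ≤
          #(Set.Iio (a i).ord) := by
        refine Cardinal.mk_le_of_injective (f := fun x => x ⟨i, rfl⟩) fun x y hxy => ?_
        funext ⟨k, hk⟩
        obtain rfl := Set.mem_singleton_iff.1 hk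
        exact hxy
      exact (Cardinal.mk_set_le _).trans (h1.trans (by simp)))
  obtain ⟨i, hi, hlt, α, β, hαβ, htt, hL, hU⟩ := hsep _ (hB.positive γ)
  refine ⟨α, β, hαβ, fun ζ η => (hc _ _ (htt ζ η) γ).2 ⟨i, ⟨?_, ?_⟩, hi⟩⟩
  · intro j hj
    by_contra! hij
    exact absurd (hU ζ η j hij) (not_lt.2 hj)
  · intro k hk
    exact hk (hL ζ η i rfl hlt.le)

/-- The fibres of a bijection `θ ≃ θ × θ` over the first factor have size `θ`, too large to be
bounded. -/
theorem exists_isPositivePartition (hθ : θ.IsRegular) (ha : StrictMono a) :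
    ∃ B : Set.Iio θ.ord → Set Cardinal.{u},
      IsPositivePartition a (boundedIdeal (Set.Iio θ.ord)) θ B := by
  have hcard : #(Set.Iio θ.ord) = #(Set.Iio θ.ord × Set.Iio θ.ord) := by
    have h : ℵ₀ ≤ #(Set.Iio θ.ord) := by simpa using hθ.aleph0_le
    rw [Cardinal.mk_prod, Cardinal.lift_id, Cardinal.mul_eq_self h]
  obtain ⟨e⟩ := Cardinal.eq.1 hcard
  refine ⟨fun l => a '' {i | (e i).1 = l}, ?_, ?_, ?_⟩
  · intro j k hjk
    rw [Set.disjoint_left]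
    rintro _ ⟨i, hi, rfl⟩ ⟨i', hi', heq⟩
    obtain rfl := ha.injective heq
    exact hjk (hi.symm.trans hi')
  · ext x
    simp only [Set.mem_iUnion, Set.mem_range]
    constructor
    · rintro ⟨_, i, -, rfl⟩
      exact ⟨i, rfl⟩
    · rintro ⟨i, rfl⟩
      exact ⟨_, i, rfl, rfl⟩
  · rintro l ⟨b, hb⟩
    have hlim := Cardinal.isSuccLimit_ord hθ.aleph0_le
    have h1 : #(Set.Iio θ.ord) ≤ #(Set.Iio (Order.succ (b : Ordinal))) := by
      refine Cardinal.mk_le_of_injective (f := fun x => ⟨e.symm (l, x), Set.mem_Iio.2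
        (Order.lt_succ_iff.2 (Subtype.coe_le_coe.2 (hb ⟨_, ?_, rfl⟩)))⟩) ?_
      · simp
      · intro x y hxy
        have h2 : e.symm (l, x) = e.symm (l, y) := by
          simpa only [Subtype.mk.injEq, ← Subtype.ext_iff] using hxy
        exact (Prod.mk.inj (e.symm.injective h2)).2
    refine absurd (h1.trans_lt (mk_Iio_lt_lift (hlim.succ_lt b.2))) ?_
    simp

end Coloring

/-! ### Scales with small restrictions, and the derived coloring. -/

section SmallRestrictions

variable {θ ν : Cardinal.{u}} {a : Set.Iio θ.ord → Cardinal.{u}}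

/-- The restriction of a family of cardinals to the indices `i ≥ i₂`. -/
abbrev tailFamily (a : Set.Iio θ.ord → Cardinal.{u}) (i₂ : Set.Iio θ.ord) :
    {i // i₂ ≤ i} → Cardinal.{u} :=
  fun i => a i

theorem isProgressiveFamily_tailFamily (ha : StrictMono a) (hθ : θ.IsRegular)
    (hreg : ∀ i, (a i).IsRegular) {i₂ : Set.Iio θ.ord} (hi₂ : Order.succ θ < a i₂) :
    IsProgressiveFamily (tailFamily a i₂) (Order.succ θ) where
  isRegular i := hreg i
  isRegular_bound := Cardinal.isRegular_succ hθ.aleph0_le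
  bound_lt i := hi₂.trans_le (ha.monotone i.2)
  mk_lt := by
    refine (Cardinal.mk_subtype_le _).trans_lt ?_
    rw [Cardinal.mk_Iio_ordinal, Cardinal.card_ord, Cardinal.lift_lt]
    exact Order.lt_succ θ

/-- The ultrafilter is transported along the injective `a`; the ideal consists of the sets with null
preimage. Coordinates before `i₂` are invisible to it and get the value `0`. -/
theorem ultraCof_tailFamily_mem_pcf {κ : Cardinal.{u}} (ha : StrictMono a)
    (hreg : ∀ i, (a i).IsRegular)
    {i₂ : Set.Iio θ.ord} (hP : IsProgressiveFamily (tailFamily a i₂) κ) {j : {i // i₂ ≤ i}}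
    {D : Ultrafilter {i // i₂ ≤ i}} (hD : Set.Iio j ∈ D) :
    ultraCof (tailFamily a i₂) D ∈ pcf (Set.range a ∩ Set.Iio (a j)) := by
  classical
  have hb : ∀ᶠ i : {i // i₂ ≤ i} in (D : Filter {i // i₂ ≤ i}),
      a i ∈ Set.range a ∩ Set.Iio (a j) := by
    filter_upwards [hD] with i hi
    exact ⟨⟨i, rfl⟩, ha hi⟩
  obtain ⟨G, hG, hGc⟩ := hP.exists_increasing_cofinal D
  choose e he using fun x : (Set.range a ∩ Set.Iio (a j) : Set Cardinal.{u}) => x.2.1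
  let F : Set.Iio (ultraCof (tailFamily a i₂) D).ord →
      CardProd (fun x : (Set.range a ∩ Set.Iio (a j) : Set Cardinal.{u}) => (x : Cardinal.{u})) :=
    fun γ x => if h : i₂ ≤ e x then ⟨G γ ⟨e x, h⟩, by
        have h1 := Set.mem_Iio.1 (G γ ⟨e x, h⟩).2
        exact Set.mem_Iio.2 (h1.trans_eq (congrArg Cardinal.ord (he x)))⟩
      else ⟨0, by
        exact Set.mem_Iio.2 ((hreg (e x)).ord_pos.trans_eq (congrArg Cardinal.ord (he x)))⟩
  have hF : ∀ γ (i : {i // i₂ ≤ i}) (h : a i ∈ Set.range a ∩ Set.Iio (a j)),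
      (F γ ⟨a i, h⟩ : Ordinal) = G γ i := by
    intro γ i h
    have h1 : e ⟨a i, h⟩ = i := ha.injective (he ⟨a i, h⟩)
    have h2 : i₂ ≤ e ⟨a i, h⟩ := i.2.trans_eq h1.symm
    have h3 : (⟨e ⟨a i, h⟩, h2⟩ : {i // i₂ ≤ i}) = i := Subtype.ext h1
    simp only [F, dif_pos h2]
    exact congrArg (fun k => (G γ k : Ordinal)) h3
  refine ⟨{s | ∀ᶠ i : {i // i₂ ≤ i} in (D : Filter {i // i₂ ≤ i}), ∀ h, ⟨a i, h⟩ ∉ s},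
    ⟨?_, ?_, ?_, ?_⟩,
    hP.isRegular_ultraCof D, F, ?_, ?_⟩
  · simp
  · intro s t hst ht
    filter_upwards [ht] with i hi h hs
    exact hi h (hst hs)
  · intro s t hs ht
    filter_upwards [hs, ht] with i h1 h2 h
    exact fun h3 => h3.elim (h1 h) (h2 h)
  · intro h
    obtain ⟨i, h1, h2⟩ := (Filter.Eventually.and h hb).exists
    exact h1 h2 (Set.mem_univ _)
  · intro α β hαβ
    filter_upwards [hG β β.2 α hαβ] with i hi h hn
    refine hn (Subtype.coe_lt_coe.1 ?_)
    rw [hF, hF]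
    exact hi
  · intro g
    obtain ⟨γ, hγ, hle⟩ := hGc fun i => if h : a i ∈ Set.range a ∩ Set.Iio (a j) then g ⟨a i, h⟩
      else ⟨0, (hreg i).ord_pos⟩
    refine ⟨⟨γ, hγ⟩, ?_⟩
    filter_upwards [hle] with i hi h hn
    rw [dif_pos h] at hi
    refine hn (Subtype.coe_lt_coe.1 ?_)
    rw [hF]
    exact hi

theorem maxCof_tailFamily_lt {κ : Cardinal.{u}} (ha : StrictMono a)
    (hreg : ∀ i, (a i).IsRegular)
    (ht : IsTortoise (Set.range a)) {i₂ : Set.Iio θ.ord}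
    (hP : IsProgressiveFamily (tailFamily a i₂) κ) (j : {i // i₂ ≤ i}) :
    maxCof (tailFamily a i₂) (Set.Iio j) < a j := by
  rcases (Set.Iio j).eq_empty_or_nonempty with h | h
  · rw [h]
    have : {c | ∃ D : Ultrafilter {i // i₂ ≤ i}, ∅ ∈ D ∧ ultraCof (tailFamily a i₂) D = c} = ∅ := by
      ext c
      simp [Ultrafilter.empty_notMem]
    rw [maxCof, this, csSup_empty]
    exact (hreg j).pos
  · obtain ⟨D, hD, hcof⟩ := hP.exists_ultraCof_eq_maxCof h
    rw [← hcof]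
    exact ht.2 _ ⟨j, rfl⟩ _ (ultraCof_tailFamily_mem_pcf ha hreg hP hD)

theorem mk_finset_lt {α : Type v} {c : Cardinal.{v}} (hc : ℵ₀ ≤ c) (h : #α < c) :
    #(Finset α) < c := by
  classical
  rcases finite_or_infinite α with hf | hf
  · exact (Cardinal.lt_aleph0_of_finite _).trans_le hc
  · rwa [Cardinal.mk_finset_of_infinite]

/-- A family of functions that is cofinal on a tail and has small sets of restrictions. -/
theorem exists_family_small_restrictions (ha : StrictMono a) (hθ : θ.IsRegular)
    (hreg : ∀ i, (a i).IsRegular) (ht : IsTortoise (Set.range a)) {i₂ : Set.Iio θ.ord}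
    (hi₂ : Order.succ θ < a i₂) :
    ∃ 𝓕 : Set (CardProd a), (∀ j : Set.Iio θ.ord,
        #((fun h : CardProd a => fun i : Set.Iio j => h i) '' 𝓕) < Cardinal.lift.{u + 1} (a j)) ∧
      ∀ g : CardProd a, ∃ h ∈ 𝓕, ∀ i, i₂ ≤ i → g i ≤ h i := by
  classical
  have hP := isProgressiveFamily_tailFamily ha hθ hreg hi₂
  have hf : ∀ l : Cardinal.{u}, ∃ f : Ordinal.{u} → CardProd (tailFamily a i₂),
      l.IsRegular → Order.succ θ < l → IsUniversalSeq (tailFamily a i₂) l f := by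
    intro l
    by_cases h : l.IsRegular ∧ Order.succ θ < l
    · obtain ⟨f, hf⟩ := hP.exists_isUniversalSeq h.1 h.2
      exact ⟨f, fun _ _ => hf⟩
    · have := hP.nonempty
      exact ⟨fun _ => Classical.arbitrary _, fun h1 h2 => absurd ⟨h1, h2⟩ h⟩
  choose f hf using hf
  have hl : ∀ j, ∃ l : Cardinal.{u}, l < a j ∧
      ∀ h : i₂ ≤ j, maxCof (tailFamily a i₂) (Set.Iio ⟨j, h⟩) = l := by
    intro j
    by_cases h : i₂ ≤ j
    · exact ⟨_, maxCof_tailFamily_lt ha hreg ht hP ⟨j, h⟩, fun _ => rfl⟩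
    · exact ⟨0, (hreg j).pos, fun h' => absurd h' h⟩
  choose l hl hmax using hl
  -- The successor admits `max pcf` itself as first entry of a code. A code is a finite set of pairs
  -- of ordinals, the first standing for a cardinal.
  let o : Set.Iio θ.ord → Ordinal.{u} := fun j => Order.succ (l j).ord
  let T : Set.Iio θ.ord → Type (u + 1) := fun j => Finset (Set.Iio (o j) × Set.Iio (o j))
  let Φ : ∀ j, T j → Set.Iio θ.ord → Ordinal.{u} := fun j S i =>
    if h : i₂ ≤ i then
      S.sup fun q => clubBound q.2 fun c => f (Ordinal.card q.1) c ⟨i, h⟩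
    else 0
  refine ⟨{h | ∀ j, ∃ S : T j, ∀ i : Set.Iio j, (h i : Ordinal) = Φ j S i}, fun j => ?_,
    fun g => ?_⟩
  · have hT : #(T j) < Cardinal.lift.{u + 1} (a j) := by
      have hinf : ℵ₀ ≤ Cardinal.lift.{u + 1} (a j) := Cardinal.aleph0_le_lift.2 (hreg j).aleph0_le
      refine mk_finset_lt hinf ?_
      have h1 : #(Set.Iio (o j)) < Cardinal.lift.{u + 1} (a j) :=
        mk_Iio_lt_lift ((Cardinal.isSuccLimit_ord (hreg j).aleph0_le).succ_lt
          (Cardinal.ord_lt_ord.2 (hl j)))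
      rw [Cardinal.mk_prod, Cardinal.lift_id]
      exact Cardinal.mul_lt_of_lt hinf h1 h1
    have hch : ∀ x : ((fun h : CardProd a => fun i : Set.Iio j => h i) ''
        {h | ∀ j, ∃ S : T j, ∀ i : Set.Iio j, (h i : Ordinal) = Φ j S i}),
        ∃ S : T j, ∀ i : Set.Iio j, (x.1 i : Ordinal) = Φ j S i := by
      rintro ⟨_, h, hh, rfl⟩
      exact hh j
    choose S hS using hch
    refine (Cardinal.mk_le_of_injective (f := S) fun x y hxy => ?_).trans_lt hT
    refine Subtype.ext (funext fun i => Subtype.ext ?_)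
    rw [hS, hS, hxy]
  · have h𝒴 : #(Set.range fun j : {i // i₂ ≤ i} => Set.Iio j) ≤
        Cardinal.lift.{u + 1} (Order.succ θ) := Cardinal.mk_range_le.trans hP.mk_lt.le
    obtain ⟨h, hgh, hY⟩ := hP.exists_ge_clubBound
      (Order.lt_succ_iff.2 hθ.aleph0_le) hf h𝒴 (fun i => g i)
    let h' : CardProd a := fun i => if hi : i₂ ≤ i then h ⟨i, hi⟩ else ⟨0, (hreg i).ord_pos⟩
    have hh' : ∀ i (hi : i₂ ≤ i), h' i = h ⟨i, hi⟩ := fun i hi => dif_pos hi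
    refine ⟨h', fun j => ?_, fun i hi => ?_⟩
    · by_cases hj : i₂ ≤ j
      · obtain ⟨S, hS, hS1, hS2⟩ := hY _ ⟨⟨j, hj⟩, rfl⟩
        rw [hmax] at hS1
        have ho : ∀ q ∈ S, q.1.ord < o j ∧ q.2 < o j := fun q hq =>
          ⟨Order.lt_succ_iff.2 (Cardinal.ord_le_ord.2 (hS1 q hq).1),
            Order.lt_succ_iff.2 ((hS1 q hq).2.1.le.trans (Cardinal.ord_le_ord.2 (hS1 q hq).1))⟩
        let S' : T j := hS.toFinset.attach.image fun q =>
          (⟨q.1.1.ord, (ho _ (hS.mem_toFinset.1 q.2)).1⟩,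
            ⟨q.1.2, (ho _ (hS.mem_toFinset.1 q.2)).2⟩)
        refine ⟨S', fun i => ?_⟩
        by_cases hi : i₂ ≤ i
        · simp only [Φ, dif_pos hi]
          rw [hh' i hi]
          apply le_antisymm
          · obtain ⟨q, hq, hle⟩ := hS2 ⟨i, hi⟩ i.2
            refine hle.trans ?_
            have hmem : ((⟨q.1.ord, (ho q hq).1⟩, ⟨q.2, (ho q hq).2⟩) :
                Set.Iio (o j) × Set.Iio (o j)) ∈ S' :=
              Finset.mem_image.2 ⟨⟨q, hS.mem_toFinset.2 hq⟩, Finset.mem_attach _ _, rfl⟩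
            refine le_trans (le_of_eq ?_) (Finset.le_sup (f := fun q : Set.Iio (o j) ×
              Set.Iio (o j) => clubBound q.2 fun c => f (Ordinal.card q.1) c ⟨i, hi⟩) hmem)
            simp only [Cardinal.card_ord]
          · refine Finset.sup_le fun p hp => ?_
            obtain ⟨q, -, rfl⟩ := Finset.mem_image.1 hp
            simp only [Cardinal.card_ord]
            exact (hS1 _ (hS.mem_toFinset.1 q.2)).2.2 ⟨i, hi⟩
        · simp only [Φ, dif_neg hi, h']
      · refine ⟨∅, fun i => ?_⟩
        have hi : ¬ i₂ ≤ (i : Set.Iio θ.ord) := fun hi => hj (hi.trans (le_of_lt i.2))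
        simp only [Φ, dif_neg hi, h']
    · rw [hh' i hi]
      exact hgh ⟨i, hi⟩

/-- Interleaving: the new `α`-th function lies in `𝓕` and above a member of `f₀` past both `f₀ α`
and all the functions already chosen. -/
theorem IsScale.exists_isScale_mem (hθ : θ.IsRegular) (hν : ν.IsRegular)
    {f₀ : Set.Iio ν.ord → CardProd a} (hf₀ : IsScale a (boundedIdeal (Set.Iio θ.ord)) ν f₀)
    {𝓕 : Set (CardProd a)} {i₂ : Set.Iio θ.ord}
    (h𝓕 : ∀ g : CardProd a, ∃ h ∈ 𝓕, ∀ i, i₂ ≤ i → g i ≤ h i) :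
    ∃ f : Set.Iio ν.ord → CardProd a, IsScale a (boundedIdeal (Set.Iio θ.ord)) ν f ∧
      ∀ α, f α ∈ 𝓕 := by
  have hX : Nonempty (CardProd a) := ⟨f₀ ⟨0, hν.ord_pos⟩⟩
  have htrans : ∀ {g h k : CardProd a}, LtMod (boundedIdeal (Set.Iio θ.ord)) g h →
      (∃ i, ∀ j, i ≤ j → h j ≤ k j) → LtMod (boundedIdeal (Set.Iio θ.ord)) g k := by
    rintro g h k h1 ⟨i, hi⟩
    obtain ⟨i', hi'⟩ := (ltMod_boundedIdeal_iff hθ).1 h1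
    exact (ltMod_boundedIdeal_iff hθ).2 ⟨max i i', fun j hj =>
      (hi' j ((le_max_right _ _).trans hj)).trans_le (hi j ((le_max_left _ _).trans hj))⟩
  have hle : ∀ α β, α ≤ β → ∃ i, ∀ j, i ≤ j → f₀ α j ≤ f₀ β j := by
    intro α β h
    rcases h.eq_or_lt with rfl | h
    · exact ⟨i₂, fun j _ => le_rfl⟩
    · obtain ⟨i, hi⟩ := (ltMod_boundedIdeal_iff hθ).1 (hf₀.increasing α β h)
      exact ⟨i, fun j hj => (hi j hj).le⟩
  obtain ⟨φ, hφ⟩ := exists_transfinite (X := CardProd a) ν.ord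
    (fun α s x => x ∈ 𝓕 ∧ (∀ β, LtMod (boundedIdeal (Set.Iio θ.ord)) (s β) x) ∧
      ∀ h : α < ν.ord, LtMod (boundedIdeal (Set.Iio θ.ord)) (f₀ ⟨α, h⟩) x) (fun α hα s _ => by
    choose γ hγ using fun β => hf₀.cofinal (s β)
    obtain ⟨b, hb, hlt⟩ := exists_lt_ord_of_mk_lt hν (mk_Iio_lt_lift hα)
      (fun β => (γ β : Ordinal)) (fun β => (γ β).2)
    obtain ⟨δ, hδ⟩ := exists_gt_Iio_ord hν (max ⟨α, hα⟩ ⟨b, hb⟩)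
    obtain ⟨x, hx, hxδ⟩ := h𝓕 (f₀ δ)
    refine ⟨x, hx, fun β => ?_, fun _ => ?_⟩
    · have h1 : γ β < ⟨b, hb⟩ := hlt β
      exact htrans (htrans (hγ β) (hle _ δ (h1.trans ((le_max_right _ _).trans_lt hδ)).le))
        ⟨i₂, hxδ⟩
    · exact htrans (hf₀.increasing _ δ ((le_max_left _ _).trans_lt hδ)) ⟨i₂, hxδ⟩)
  refine ⟨fun α => φ α, ⟨fun α β h => (hφ β β.2).2.1 ⟨α, h⟩, fun g => ?_⟩, fun α => (hφ α α.2).1⟩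
  obtain ⟨α, hα⟩ := hf₀.cofinal g
  obtain ⟨i, hi⟩ := (ltMod_boundedIdeal_iff hθ).1 ((hφ α α.2).2.2 α.2)
  exact ⟨α, htrans hα ⟨i, fun j hj => (hi j hj).le⟩⟩

theorem power_lt_of_lt_aleph0 {c x n : Cardinal.{v}} (hc : ℵ₀ ≤ c) (hx : x < c) (hn : n < ℵ₀) :
    x ^ n < c := by
  rcases lt_or_ge x ℵ₀ with h | h
  · exact (Cardinal.power_lt_aleph0 h hn).trans_le hc
  · obtain ⟨n, rfl⟩ := Cardinal.lt_aleph0.1 hn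
    exact (Cardinal.power_nat_le h).trans_lt hx

theorem IsScale.exists_derivedColoring {κ : Cardinal.{u}} (hθ : θ.IsRegular) (hν : ν.IsRegular)
    (ha : StrictMono a) (hreg : ∀ i, (a i).IsRegular) (hθa : ∃ i, θ < a i)
    {f : Set.Iio ν.ord → CardProd a} (hf : IsScale a (boundedIdeal (Set.Iio θ.ord)) ν f)
    (hsmall : SmallRestrictions a ν f) {A : Set.Iio κ.ord → Set Cardinal.{u}}
    (hA : IsPositivePartition a (boundedIdeal (Set.Iio θ.ord)) κ A) :
    ∃ c, IsDerivedColoring a ν κ f A c ∧ WitnessesPr1 ν ν κ ℵ₀ c := by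
  obtain ⟨c, hc⟩ := hA.exists_coloring (ν := ν) hθ (fun α β => {i | ∀ j, i ≤ j → f α j < f β j})
    (fun α β h => (ltMod_boundedIdeal_iff hθ).1 (hf.increasing α β h))
  refine ⟨c, hc, fun ξ hξ t ht γ => ?_⟩
  have hξ' : ξ < θ.ord := hξ.trans_le (Cardinal.ord_le_ord.2 hθ.aleph0_le)
  have hfin : #(Set.Iio ξ) < ℵ₀ := by simpa using mk_Iio_lt_lift hξ
  obtain ⟨i₂, hi₂⟩ := hθa
  obtain ⟨m, hm⟩ := exists_row_bound ha hreg hξ' hi₂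
  obtain ⟨i₀, hsep⟩ := hf.exists_separated_rows hθ hν ha hreg hξ' ht hi₂
    (L := fun i => Set.Iio i) (U := fun i => Set.Ici i) (fun i => Set.Iio_subset_Iic_self)
    (fun i => ⟨i, Set.self_mem_Ici⟩) (fun i => le_rfl)
    (M := fun β j => m j fun ζ => f (t β ζ) j)
    (fun β ζ j hj => hm j hj (fun ζ => f (t β ζ) j) ζ)
    -- Finiteness of the rows enters here: fewer than `a i` restrictions give fewer than `a i`
    -- finite tuples of them.
    (fun i j hj => by
      refine lt_of_lt_of_le (b := Cardinal.lift.{u + 1} (a i)) ?_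
        (Cardinal.lift_le.2 (ha.monotone hj))
      let R := Set.range fun α => fun k : Set.Iio i => f α k
      have h1 : #(Set.Iio ξ → R) < Cardinal.lift.{u + 1} (a i) := by
        rw [← Cardinal.power_def]
        exact power_lt_of_lt_aleph0 (Cardinal.aleph0_le_lift.2 (hreg i).aleph0_le) (hsmall i) hfin
      refine lt_of_le_of_lt (Cardinal.mk_le_of_injective (f := fun x :
        Set.range (fun β => fun k : Set.Iio i => m k fun ζ => f (t β ζ) k) => fun ζ =>
        (⟨_, t x.2.choose ζ, rfl⟩ : R)) fun x y hxy => ?_) h1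
      refine Subtype.ext ?_
      rw [← x.2.choose_spec, ← y.2.choose_spec]
      funext k
      refine congrArg (m k) (funext fun ζ => ?_)
      exact congrFun (congrArg Subtype.val (congrFun hxy ζ)) k)
  obtain ⟨i, hi, hlt, α, β, hαβ, htt, hL, hU⟩ := hsep _ (hA.positive γ)
  refine ⟨α, β, hαβ, fun ζ η => (hc _ _ (htt ζ η) γ).2 ⟨i, ⟨hU ζ η, ?_⟩, hi⟩⟩
  intro k hk
  by_contra! hki
  -- If the final domination began at `k < i`, it would hold at `max k i₀`, which lies in `[i₀, i)`,
  -- where the order is reversed.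
  exact absurd (hk (max k i₀) (le_max_left _ _))
    (hL ζ η (max k i₀) (max_lt hki hlt) (le_max_right _ _)).not_gt

end SmallRestrictions

theorem mainTheorem3 (κ θ μ : Cardinal.{u}) (hκ : κ < θ) (hθ : θ = μ.ord.cof) (hμ : θ < μ)
    (a : Set.Iio θ.ord → Cardinal.{u}) (ha_mono : StrictMono a)
    (ha_reg : ∀ i, (a i).IsRegular) (ha_lt : ∀ i, a i < μ)
    (ha_lim : ∀ d, d < μ → ∃ i, d < a i) :
    (HasTcf a (boundedIdeal (Set.Iio θ.ord)) (Order.succ μ) →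
      IsTortoise (Set.range a) →
      ∀ A : Set.Iio κ.ord → Set Cardinal.{u},
        IsPositivePartition a (boundedIdeal (Set.Iio θ.ord)) κ A →
        ∃ f : Set.Iio (Order.succ μ).ord → CardProd a,
          IsScale a (boundedIdeal (Set.Iio θ.ord)) (Order.succ μ) f ∧
          SmallRestrictions a (Order.succ μ) f ∧
          ∃ c, IsDerivedColoring a (Order.succ μ) κ f A c ∧
            WitnessesPr1 (Order.succ μ) (Order.succ μ) κ ℵ₀ c) ∧
    (∀ ν : Cardinal.{u}, ν.IsRegular →
      ∀ f : Set.Iio ν.ord → CardProd a,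
        IsScale a (boundedIdeal (Set.Iio θ.ord)) ν f →
        (∀ (ρ : Cardinal.{u}) (B : Set.Iio ρ.ord → Set Cardinal.{u}),
          IsPositivePartition a (boundedIdeal (Set.Iio θ.ord)) ρ B →
          ∃ c, IsLastFailureColoring a ν ρ f B c ∧ WitnessesPr1 ν ν ρ θ c) ∧
        Pr1 ν ν θ θ) := by
  obtain ⟨i₁, hi₁⟩ := ha_lim θ hμ
  have hμinf : ℵ₀ ≤ μ := (ha_reg i₁).aleph0_le.trans (ha_lt i₁).le
  have hθreg : θ.IsRegular := by
    rw [hθ]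
    exact Cardinal.isRegular_cof (Cardinal.isSuccLimit_ord hμinf)
  constructor
  · rintro ⟨hν, f₀, hf₀⟩ ht A hA
    -- One index further gives `θ⁺ < a i₂`; the approximation runs for `θ⁺` steps because it needs a
    -- regular uncountable length exceeding `θ`.
    obtain ⟨i₂, hi₂⟩ := exists_gt_Iio_ord hθreg i₁
    have hsucc : Order.succ θ < a i₂ := (Order.succ_le_of_lt hi₁).trans_lt (ha_mono hi₂)
    obtain ⟨𝓕, hsmall, h𝓕⟩ := exists_family_small_restrictions ha_mono hθreg ha_reg ht hsucc
    obtain ⟨f, hf, hmem⟩ := hf₀.exists_isScale_mem hθreg hν h𝓕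
    have hres : SmallRestrictions a (Order.succ μ) f := by
      intro j
      refine (Cardinal.mk_le_mk_of_subset ?_).trans_lt (hsmall j)
      rintro _ ⟨α, rfl⟩
      exact ⟨f α, hmem α, rfl⟩
    exact ⟨f, hf, hres,
      hf.exists_derivedColoring hθreg hν ha_mono ha_reg ⟨i₁, hi₁⟩ hres hA⟩
  · intro ν hν f hf
    refine ⟨fun ρ B hB =>
      hf.exists_lastFailureColoring hθreg hν ha_mono ha_reg ⟨i₁, hi₁⟩ hB, ?_⟩
    obtain ⟨B, hB⟩ := exists_isPositivePartition hθreg ha_mono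
    obtain ⟨c, -, hc⟩ := hf.exists_lastFailureColoring hθreg hν ha_mono ha_reg ⟨i₁, hi₁⟩ hB
    exact ⟨c, hc⟩
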